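/- **Definitions.** Let $P(t)=\sum_{n\ge0}\gamma_nt^n\in\mathbb C[[t]]$. It is *tame* if there are $u,v>0$ with $u\le|\gamma_{n-1}/\gamma_n|\le v$ for all large $n$; let $r_P$ be its radius of convergence. Put $X_n(P)=\sum_{k=0}^n\frac{\gamma_{n-k}}{\gamma_n}s^k$ (for large $n$), let $\Omega(P)\subset\mathbb C[[s]]$ be the set of accumulation points of $(X_n(P))_n$ for coefficientwise convergence, let $\mathbb C\Omega(P)$ be its linear span, and $d_P=\operatorname{rank}\mathbb C\Omega(P)$. A subset of $\mathbb Z_{\ge0}$ is *rational* if from some point on it is periodic. $P$ is *finitely rationally accumulating* if $\Omega(P)$ is finite and its points have pairwise disjoint open neighbourhoods $\mathcal V_a$ such that the sets $U_a=\{n: X_n(P)\in\mathcal V_a\}$, $a\in\Omega(P)$, are rational and, outside a finite set, decompose $\mathbb Z_{\ge0}$ disjointly. A *period* is an integer $h\ge1$ such that, up to finitely many integers, each residue class $U^{[e]}=\{n\ge0: n\equiv e\bmod h\}$ is contained in one of the $U_a$ (the least one is the period $h_P$). For such an $h$ and $[e]\in\mathbb Z/h\mathbb Z$ the limit $a^{[e]}(s)=\lim_{n\to\infty,\,n\equiv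 e\,(h)}X_n(P)$ exists; let $a_1^{[e]}$ be its coefficient of $s$, and $$A^{[e]}(s)=\sum_{j=0}^{h-1}\Big(\prod_{i=1}^{j}a_1^{[e-i+1]}\Big)s^j,\qquad A_P=\prod_{i=0}^{h-1}a_1^{[i]}.$$ The *opposite denominator polynomial* is $\Delta_P^{op}(s)=(1-A_Ps^h)/\delta(s)$, where $\delta(s)=\gcd(A^{[e]}(s),1-A_Ps^h)$ (independent of $[e]$) with constant term normalized to $1$. For $r>0$, $\mathbb C\{t\}_r$ is the set of power series that converge on $|t|<r$ and continue to a meromorphic function on a neighbourhood of $|t|\le r$. For $P\in\mathbb C\{t\}_r$ let $\Delta_P(t)=\prod_i(t-x_i)^{d_i}$ (with distinct $x_i$, $d_i\geq 1$) be the monic polynomial of lowest degree such that $\Delta_PP$ is holomorphic near the circle $|t|=r$; the *top denominator polynomial* is $\Delta_P^{top}(t)=\prod_{d_i=\max_k d_k}(t-x_i)$. Its roots are the poles of $P$ of highest order on $|t|=r$. Let $T^{[e]}P=\sum_{n\equiv e\,(h)}\gamma_nt^n$. **Theorem (Duality).** Let $P$ be a tame power series belonging to $\mathbb C\{t\}_r$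 for $r=r_P$, and suppose that $P$ is finitely rationally accumulating, with period $h$. Then: (i) $\deg\Delta_P^{top}=d_P=\deg\Delta_P^{op}$, and $$t^{d_P}\Delta_P^{op}(t^{-1})=\Delta_P^{top}(t),\qquad s^{d_P}\Delta_P^{top}(s^{-1})=\Delta_P^{op}(s).$$ In particular $d_P=\operatorname{rank}\mathbb C\Omega(P)$ is finite and equals the number of poles of highest order of $P$ on $|t|=r_P$. (ii) Each $T^{[e]}P$ belongs to $\mathbb C\{t\}_r$; the meromorphic function $P/T^{[e]}P$ has a finite value at each root $x_i$ of $\Delta_P^{top}$, and $$\Big(\tfrac{P(t)}{T^{[e]}P(t)}\Big|_{t=x_i}\Big)_{[e]\in\mathbb Z/h\mathbb Z,\ \Delta_P^{top}(x_i)=0}=\Big(A^{[e]}(x_i^{-1})\Big)_{[e]\in\mathbb Z/h\mathbb Z,\ \Delta_P^{top}(x_i)=0}.$$ This matrix has maximal rank $d_P$. -/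

import Mathlib

open Filter Topology Polynomial
open scoped PowerSeries.WithPiTopology

noncomputable section

/-! ### Tame series and the space of opposite series -/

/-- A power series `∑ γₙ tⁿ` is tame if `u ≤ |γₙ₋₁ / γₙ| ≤ v` for all large `n`, for some
positive reals `u`, `v`. (The lower bound forces `γₙ ≠ 0`, because `x / 0 = 0`.) -/
def IsTame (P : PowerSeries ℂ) : Prop :=
  ∃ u v : ℝ, 0 < u ∧ 0 < v ∧ ∀ᶠ n : ℕ in atTop,
    u ≤ ‖PowerSeries.coeff n P / PowerSeries.coeff (n + 1) P‖ ∧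
      ‖PowerSeries.coeff n P / PowerSeries.coeff (n + 1) P‖ ≤ v

/-- The radius of convergence `r_P` of a power series (for a tame series it is neither `0` nor
`∞`). -/
def convRadius (P : PowerSeries ℂ) : ℝ :=
  (FormalMultilinearSeries.ofScalars ℂ fun n => PowerSeries.coeff n P).radius.toReal

/-- The opposite polynomial `Xₙ(P) = ∑_{k ≤ n} (γₙ₋ₖ / γₙ) sᵏ`, as an element of `ℂ[[s]]`. -/
def oppositePoly (P : PowerSeries ℂ) (n : ℕ) : PowerSeries ℂ :=
  PowerSeries.mk fun k =>
    if k ≤ n then PowerSeries.coeff (n - k) P / PowerSeries.coeff n P else 0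

/-- The set of accumulation points of a sequence. -/
def accumulationSet {T : Type*} [TopologicalSpace T] (x : ℕ → T) : Set T :=
  {a | MapClusterPt a atTop x}

/-- The space `Ω(P)` of opposite series: the accumulation points of the opposite polynomials in
`ℂ[[s]]` with the topology of coefficientwise convergence. -/
def oppositeSpace (P : PowerSeries ℂ) : Set (PowerSeries ℂ) :=
  accumulationSet (oppositePoly P)

/-- The linear span `ℂΩ(P)` of `Ω(P)` in `ℂ[[s]]`. -/
def oppositeSpan (P : PowerSeries ℂ) : Submodule ℂ (PowerSeries ℂ) :=
  Submodule.span ℂ (oppositeSpace P)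

/-- `d_P = rank ℂΩ(P)`. -/
def oppositeRank (P : PowerSeries ℂ) : ℕ := Module.finrank ℂ (oppositeSpan P)

/-! ### Finite rational accumulation -/

/-- The residue class `U^[e] = {n ≥ 0 | n ≡ e mod h}`. -/
def residueSet (h : ℕ) (e : ZMod h) : Set ℕ := {n | (n : ZMod h) = e}

/-- A rational subset of `ℕ`: one that is periodic from some point on. -/
def IsRationalSubset (U : Set ℕ) : Prop :=
  ∃ h : ℕ, 0 < h ∧ ∀ᶠ n : ℕ in atTop, (n + h ∈ U ↔ n ∈ U)

/-- A finite rational partition of `ℕ`: finitely many rational subsets which, outside a finite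
set, decompose `ℕ` disjointly. -/
structure IsFiniteRationalPartition {ι : Type*} (U : ι → Set ℕ) : Prop where
  finite_index : Finite ι
  rational : ∀ a, IsRationalSubset (U a)
  partition : ∀ᶠ n : ℕ in atTop, ∃! a, n ∈ U a

/-- `h` is a period of the partition `U`: up to finitely many integers, the standard partition
into residue classes mod `h` subdivides `U`. -/
def IsPartitionPeriod {ι : Type*} (U : ι → Set ℕ) (h : ℕ) : Prop :=
  0 < h ∧ ∀ e : ZMod h, ∃ a, ∀ᶠ n : ℕ in atTop, n ∈ residueSet h e → n ∈ U a

/-- The sequence `x` is finite rationally accumulating, and `h` is a period of the accumulation: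
its accumulation set `Ω` is finite, and the points of `Ω` have pairwise disjoint open
neighbourhoods `V a` such that the sets `{n | x n ∈ V a}` form a finite rational partition of `ℕ`
which has `h` as a period. -/
def IsFinRatAccumulating {T : Type*} [TopologicalSpace T] (x : ℕ → T) (h : ℕ) : Prop :=
  ∃ V : accumulationSet x → Set T,
    (∀ a, IsOpen (V a) ∧ (a : T) ∈ V a) ∧
    (∀ a b, a ≠ b → Disjoint (V a) (V b)) ∧
    IsFiniteRationalPartition (fun a => {n | x n ∈ V a}) ∧
    IsPartitionPeriod (fun a => {n | x n ∈ V a}) h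

/-! ### The opposite denominator polynomial -/

/-- The opposite series `a^[e] = lim Xₙ(P)`, the limit being taken over `n ≡ e mod h`. -/
def oppositeSeries (P : PowerSeries ℂ) (h : ℕ) (e : ZMod h) : PowerSeries ℂ :=
  limUnder (atTop ⊓ 𝓟 (residueSet h e)) (oppositePoly P)

/-- The initial `a₁^[e]` of the opposite series `a^[e]`. -/
def oppositeInitial (P : PowerSeries ℂ) (h : ℕ) (e : ZMod h) : ℂ :=
  PowerSeries.coeff 1 (oppositeSeries P h e)

/-- The numerator polynomial `A^[e](s) = ∑_{j < h} (∏_{i = 1}^{j} a₁^[e - i + 1]) sʲ`. -/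
def numeratorPoly {h : ℕ} (a : ZMod h → ℂ) (e : ZMod h) : ℂ[X] :=
  ∑ j ∈ Finset.range h, C (∏ i ∈ Finset.Icc 1 j, a (e - (i : ZMod h) + 1)) * X ^ j

/-- `A = ∏_{i < h} a₁^[i]`. -/
def cyclicProduct {h : ℕ} (a : ZMod h → ℂ) : ℂ := ∏ i ∈ Finset.range h, a (i : ZMod h)

open Classical in
/-- `δ(s) = gcd(A^[0](s), 1 - A sʰ)`, normalized to have constant term `1`. (The gcd of
`A^[e](s)` and `1 - A sʰ` does not depend on `e`.) -/
def commonFactor {h : ℕ} (a : ZMod h → ℂ) : ℂ[X] :=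
  C ((EuclideanDomain.gcd (numeratorPoly a 0) (1 - C (cyclicProduct a) * X ^ h)).coeff 0)⁻¹ *
    EuclideanDomain.gcd (numeratorPoly a 0) (1 - C (cyclicProduct a) * X ^ h)

/-- The opposite denominator polynomial `Δ^op(s) = (1 - A sʰ) / δ(s)` of `P`. -/
def oppositeDenominator (P : PowerSeries ℂ) (h : ℕ) : ℂ[X] :=
  (1 - C (cyclicProduct (oppositeInitial P h)) * X ^ h) / commonFactor (oppositeInitial P h)

/-! ### The class `ℂ{t}_r` and the top denominator polynomial -/

/-- `f` extends the sum of `P` on the open disc of radius `r` to a meromorphic function on a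
neighbourhood of the closed disc. -/
def IsMeromorphicExtension (r : ℝ) (P : PowerSeries ℂ) (f : ℂ → ℂ) : Prop :=
  (∀ z ∈ Metric.ball (0 : ℂ) r, HasSum (fun n : ℕ => PowerSeries.coeff n P * z ^ n) (f z)) ∧
    ∃ U : Set ℂ, IsOpen U ∧ Metric.closedBall (0 : ℂ) r ⊆ U ∧ MeromorphicOn f U

/-- The class `ℂ{t}_r`. -/
def MemMeromorphicClass (r : ℝ) (P : PowerSeries ℂ) : Prop :=
  ∃ f : ℂ → ℂ, IsMeromorphicExtension r P f

open Classical in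
/-- The meromorphic function defined by `P ∈ ℂ{t}_r`. Near the closed disc of radius `r > 0` it is
unique as a meromorphic function, that is, up to its values at isolated points. -/
def meromorphicExtension (r : ℝ) (P : PowerSeries ℂ) : ℂ → ℂ :=
  if hP : MemMeromorphicClass r P then hP.choose else 0

/-- The polynomial `Q` cancels the poles of `f` on the circle `|t| = r`: the meromorphic function
`Q f` is holomorphic near the circle (after filling in removable singularities). -/
def CancelsPoles (r : ℝ) (f : ℂ → ℂ) (Q : ℂ[X]) : Prop :=
  ∃ g : ℂ → ℂ, AnalyticOnNhd ℂ g (Metric.sphere 0 r) ∧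
    ∀ x ∈ Metric.sphere (0 : ℂ) r, ∀ᶠ z in 𝓝[≠] x, g z = Q.eval z * f z

/-- `Q` is the polar part polynomial of `f`: the monic polynomial of lowest degree that cancels
the poles of `f` on `|t| = r`. -/
def IsPolarPart (r : ℝ) (f : ℂ → ℂ) (Q : ℂ[X]) : Prop :=
  Q.Monic ∧ CancelsPoles r f Q ∧
    ∀ R : ℂ[X], R.Monic → CancelsPoles r f R → Q.natDegree ≤ R.natDegree

open Classical in
/-- The polar part polynomial `Δ_P(t)` of `P ∈ ℂ{t}_r`. -/
def polarPart (r : ℝ) (P : PowerSeries ℂ) : ℂ[X] :=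
  if hQ : ∃ Q, IsPolarPart r (meromorphicExtension r P) Q then hQ.choose else 1

open Classical in
/-- The top denominator polynomial: if `Δ_P(t) = ∏ (t - xᵢ)^{dᵢ}`, it is the product of the
factors `t - xᵢ` over those `i` for which `dᵢ` is maximal. -/
def topDenominator (r : ℝ) (P : PowerSeries ℂ) : ℂ[X] :=
  ∏ x ∈ (polarPart r P).roots.toFinset with
    (polarPart r P).rootMultiplicity x =
      (polarPart r P).roots.toFinset.sup fun y => (polarPart r P).rootMultiplicity y,
    (X - C x)

/-- The set of poles of `f` on the circle `|t| = r` whose order is highest among the poles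
there. -/
def topPoles (r : ℝ) (f : ℂ → ℂ) : Set ℂ :=
  {x | ‖x‖ = r ∧ meromorphicOrderAt f x < 0 ∧
    ∀ y : ℂ, ‖y‖ = r → meromorphicOrderAt f x ≤ meromorphicOrderAt f y}

/-! ### The rational operators and the transition matrix -/

open Classical in
/-- The rational operator `T_U : ∑ γₙ tⁿ ↦ ∑_{n ∈ U} γₙ tⁿ`. -/
def rationalOp (U : Set ℕ) (P : PowerSeries ℂ) : PowerSeries ℂ :=
  PowerSeries.mk fun n => if n ∈ U then PowerSeries.coeff n P else 0

/-- The quotient `P / T^[e] P` of meromorphic functions. -/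
def transitionQuotient (r : ℝ) (P : PowerSeries ℂ) (h : ℕ) (e : ZMod h) (z : ℂ) : ℂ :=
  meromorphicExtension r P z / meromorphicExtension r (rationalOp (residueSet h e) P) z

/-- The transition matrix `((P / T^[e] P)(xᵢ))`, with `e ∈ ℤ/h` and `xᵢ` a root of the top
denominator polynomial. The value at `xᵢ` is that of the quotient as a meromorphic function, that
is, its limit at `xᵢ`. -/
def transitionMatrix (r : ℝ) (P : PowerSeries ℂ) (h : ℕ) :
    Matrix (ZMod h) ((topDenominator r P).rootSet ℂ) ℂ :=
  Matrix.of fun e x => limUnder (𝓝[≠] (x : ℂ)) (transitionQuotient r P h e)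

end

noncomputable section

/-! ### Convergence of the opposite polynomials along residue classes -/

/-! Both sides of the duality are read off from the leading coefficients of `P` at its poles of
highest order on `|t| = r`. Let `m + 1` be that order, `S` the set of these poles and `c x` the
limit of `(1 - t/x)^(m+1) P(t)` at `x`. Subtracting polar terms gives `γₙ rⁿ / C(n+m, m) = ∑_{x ∈ S}
c x (r/x)ⁿ + o(1)` (`IsMeromorphicExtension.tendsto_coeff_sub`).

Tameness confines the opposite polynomials to a compact set, so they converge along each class mod
`h`, and `γₙ / γₙ₊ₖ` is asymptotically the `k`-th coefficient of `a^[n+k]`, a product of `k`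
initials. For `k = h` this product is `A` in every class. Comparison with the leading term gives `∑
c x (1 - A/x^h) (r/x)ⁿ → 0`, and independence of unimodular exponentials forces `x^h = A` on `S`.
Hence `E(n) = ∑ c x x⁻ⁿ` is multiplied by `A⁻¹` under `n ↦ n + h`, and the asymptotic relation for
`k = 1` becomes the exact recurrence `E(n) = a₁^[n+1] E(n+1)`
(`pow_eq_cyclicProduct_and_recurrence`).

It follows that `E` has no zero and that `a^[e] = ∑_{x ∈ S} λ(e,x) / (1 - x s)` with `λ(e,x) = c x
x⁻ᵉ / E(e)`. The rest is Fourier analysis on the `h`-th roots of `A`. The matrix `λ` has a left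
inverse, so `ℂΩ(P)` is spanned by the independent series `1 / (1 - x s)`, `x ∈ S`. The value
`A^[e](x⁻¹)` is `h λ(e,x)` for `x ∈ S` and `0` at the other roots, so `Δ^op = ∏_{x ∈ S} (1 - x s)`.
Finally `T^[e] P` is an average of rotations of `P` with leading coefficient `xᵉ E(e) / h` at `x`,
so `P / T^[e] P` has the value `h λ(e,x)` there. -/

theorem IsTame.eventually_coeff_ne_zero {P : PowerSeries ℂ} (hP : IsTame P) :
    ∀ᶠ n in atTop, PowerSeries.coeff n P ≠ 0 := by
  obtain ⟨u, v, hu, -, h⟩ := hP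
  filter_upwards [h] with n hn h0
  rw [h0, zero_div, norm_zero] at hn
  linarith [hn.1]

theorem IsTame.exists_bound_div {P : PowerSeries ℂ} (hP : IsTame P) (k : ℕ) :
    ∃ B : ℝ, ∀ᶠ n in atTop,
      ‖PowerSeries.coeff n P / PowerSeries.coeff (n + k) P‖ ≤ B := by
  have hne := hP.eventually_coeff_ne_zero
  obtain ⟨u, v, hu, hv, h⟩ := hP
  refine ⟨v ^ k, ?_⟩
  induction k with
  | zero =>
    filter_upwards [hne] with n hn
    simp [hn]
  | succ k ih =>
    filter_upwards [ih, (tendsto_add_atTop_nat k).eventually h,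
      (tendsto_add_atTop_nat k).eventually hne] with n h1 h2 h3
    rw [← div_mul_div_cancel₀ h3, norm_mul, pow_succ]
    exact mul_le_mul h1 h2.2 (norm_nonneg _) (by positivity)

theorem coeff_oppositePoly_of_le (P : PowerSeries ℂ) {k n : ℕ} (h : k ≤ n) :
    PowerSeries.coeff k (oppositePoly P n) =
      PowerSeries.coeff (n - k) P / PowerSeries.coeff n P := by
  simp [oppositePoly, h]

theorem IsTame.exists_bound_coeff_oppositePoly {P : PowerSeries ℂ} (hP : IsTame P) (k : ℕ) :
    ∃ B : ℝ, ∀ n, ‖PowerSeries.coeff k (oppositePoly P n)‖ ≤ B := by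
  obtain ⟨B, hB⟩ := hP.exists_bound_div k
  have : IsBoundedUnder (· ≤ ·) atTop fun n => ‖PowerSeries.coeff k (oppositePoly P n)‖ := by
    refine ⟨B, ?_⟩
    rw [eventually_map]
    filter_upwards [(tendsto_sub_atTop_nat k).eventually hB, eventually_ge_atTop k] with n hn hk
    rw [coeff_oppositePoly_of_le P hk]
    rwa [Nat.sub_add_cancel hk] at hn
  obtain ⟨C, hC⟩ := this.bddAbove_range
  exact ⟨C, fun n => hC ⟨n, rfl⟩⟩

/-- Coefficientwise convergence is the product topology, so Tychonoff applies to a product of closed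
discs, one for each coefficient bound. -/
theorem IsTame.exists_isCompact_oppositePoly {P : PowerSeries ℂ} (hP : IsTame P) :
    ∃ K : Set (PowerSeries ℂ), IsCompact K ∧ ∀ n, oppositePoly P n ∈ K := by
  choose B hB using hP.exists_bound_coeff_oppositePoly
  refine ⟨Set.univ.pi fun d : Unit →₀ ℕ => Metric.closedBall (0 : ℂ) (B (d ())),
    isCompact_univ_pi fun d => isCompact_closedBall _ _, fun n d _ => ?_⟩
  have hd : d = Finsupp.single () (d ()) := by ext; simp
  rw [mem_closedBall_zero_iff]
  have := hB (d ()) n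
  rwa [PowerSeries.coeff, ← hd] at this

theorem neBot_atTop_inf_residueSet {h : ℕ} (hh : 0 < h) (e : ZMod h) :
    (atTop ⊓ 𝓟 (residueSet h e)).NeBot := by
  have : NeZero h := ⟨hh.ne'⟩
  rw [← frequently_mem_iff_neBot, frequently_atTop]
  intro N
  refine ⟨e.val + h * N, ?_, ?_⟩
  · nlinarith
  · simp [residueSet]

/-- Along the class the sequence eventually stays in a single `V a`, which is disjoint from the
neighbourhoods of the other accumulation points. In a compact set, a unique cluster point is a
limit. -/
theorem exists_tendsto_of_isFinRatAccumulating {T : Type*} [TopologicalSpace T] {x : ℕ → T}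
    {h : ℕ} (hx : IsFinRatAccumulating x h) {K : Set T} (hK : IsCompact K) (hxK : ∀ n, x n ∈ K)
    (e : ZMod h) : ∃ a, Tendsto x (atTop ⊓ 𝓟 (residueSet h e)) (𝓝 a) := by
  obtain ⟨V, hV, hdisj, -, -, hper⟩ := hx
  obtain ⟨a, ha⟩ := hper e
  refine ⟨a, hK.le_nhds_of_unique_clusterPt
    (mem_map.2 (Eventually.of_forall hxK)) fun b _ hb => ?_⟩
  have hbΩ : b ∈ accumulationSet x := hb.mono (map_mono inf_le_left)
  by_contra hne
  have hd := hdisj ⟨b, hbΩ⟩ a fun h => hne (congrArg Subtype.val h)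
  have h1 : ∃ᶠ y in map x (atTop ⊓ 𝓟 (residueSet h e)), y ∈ V ⟨b, hbΩ⟩ :=
    hb.frequently ((hV ⟨b, hbΩ⟩).1.mem_nhds (hV ⟨b, hbΩ⟩).2)
  have h2 : ∀ᶠ n in atTop ⊓ 𝓟 (residueSet h e), x n ∈ V a := by
    rwa [eventually_inf_principal]
  obtain ⟨n, hn1, hn2⟩ := ((frequently_map.1 h1).and_eventually h2).exists
  exact Set.disjoint_left.1 hd hn1 hn2

theorem accumulationSet_eq_range {T : Type*} [TopologicalSpace T] [T2Space T] {x : ℕ → T}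
    {h : ℕ} (hh : 0 < h) {a : ZMod h → T}
    (ha : ∀ e, Tendsto x (atTop ⊓ 𝓟 (residueSet h e)) (𝓝 (a e))) :
    accumulationSet x = Set.range a := by
  have : NeZero h := ⟨hh.ne'⟩
  ext b
  constructor
  · intro hb
    by_contra hne
    have hsep : ∀ e, ∃ U ∈ 𝓝 b, ∀ᶠ n in atTop, n ∈ residueSet h e → x n ∉ U := by
      intro e
      obtain ⟨U, W, hU, hW, hbU, haW, hd⟩ := t2_separation fun h' : b = a e => hne ⟨e, h'.symm⟩
      refine ⟨U, hU.mem_nhds hbU, ?_⟩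
      have := (ha e).eventually (hW.mem_nhds haW)
      rw [eventually_inf_principal] at this
      filter_upwards [this] with n hn he hxU
      exact Set.disjoint_left.1 hd hxU (hn he)
    choose U hU hxU using hsep
    have h1 := MapClusterPt.frequently hb (Filter.iInter_mem.2 hU)
    obtain ⟨n, hn, hn'⟩ := (h1.and_eventually (eventually_all.2 hxU)).exists
    exact hn' (n : ZMod h) rfl (Set.mem_iInter.1 hn _)
  · rintro ⟨e, rfl⟩
    have := neBot_atTop_inf_residueSet hh e
    exact MapClusterPt.mono (ha e).mapClusterPt inf_le_left

theorem tendsto_atTop_of_residueSet {h : ℕ} (hh : 0 < h) {X : Type*} {f : ℕ → X} {l : Filter X}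
    (hf : ∀ e : ZMod h, Tendsto f (atTop ⊓ 𝓟 (residueSet h e)) l) : Tendsto f atTop l := by
  have : NeZero h := ⟨hh.ne'⟩
  intro s hs
  have : ∀ e : ZMod h, ∀ᶠ n in atTop, n ∈ residueSet h e → f n ∈ s := fun e =>
    eventually_inf_principal.1 (hf e hs)
  rw [mem_map]
  filter_upwards [eventually_all.2 this] with n hn
  exact hn (n : ZMod h) rfl

section

variable {P : PowerSeries ℂ} {h : ℕ}

theorem tendsto_oppositeSeries (hP : IsTame P)
    (hacc : IsFinRatAccumulating (oppositePoly P) h) (e : ZMod h) :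
    Tendsto (oppositePoly P) (atTop ⊓ 𝓟 (residueSet h e)) (𝓝 (oppositeSeries P h e)) := by
  obtain ⟨K, hK, hxK⟩ := hP.exists_isCompact_oppositePoly
  exact tendsto_nhds_limUnder (exists_tendsto_of_isFinRatAccumulating hacc hK hxK e)

theorem IsFinRatAccumulating.pos {T : Type*} [TopologicalSpace T] {x : ℕ → T}
    (hx : IsFinRatAccumulating x h) : 0 < h := by
  obtain ⟨V, -, -, -, hpos, -⟩ := hx
  exact hpos

theorem oppositeSpace_eq_range (hP : IsTame P)
    (hacc : IsFinRatAccumulating (oppositePoly P) h) :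
    oppositeSpace P = Set.range (oppositeSeries P h) :=
  accumulationSet_eq_range hacc.pos (tendsto_oppositeSeries hP hacc)

/-- `γₙ₋ₖ / γₙ - coeffₖ a^[n]` tends to `0`. -/
theorem tendsto_coeff_div_sub (hP : IsTame P)
    (hacc : IsFinRatAccumulating (oppositePoly P) h) (k : ℕ) :
    Tendsto (fun n : ℕ => PowerSeries.coeff n P / PowerSeries.coeff (n + k) P -
      PowerSeries.coeff k (oppositeSeries P h ((n + k : ℕ) : ZMod h))) atTop (𝓝 0) := by
  have key : Tendsto (fun n : ℕ => PowerSeries.coeff k (oppositePoly P n) -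
      PowerSeries.coeff k (oppositeSeries P h (n : ZMod h))) atTop (𝓝 0) := by
    refine tendsto_atTop_of_residueSet hacc.pos fun e => ?_
    have h1 := (PowerSeries.WithPiTopology.tendsto_iff_coeff_tendsto ℂ _ _ _).1
      (tendsto_oppositeSeries hP hacc e) k
    have h2 := h1.sub_const (PowerSeries.coeff k (oppositeSeries P h e))
    rw [sub_self] at h2
    refine h2.congr' ?_
    filter_upwards [mem_inf_of_right (mem_principal_self _)] with n hn
    rw [show (n : ZMod h) = e from hn]
  refine (key.comp (tendsto_add_atTop_nat k)).congr fun n => ?_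
  simp [coeff_oppositePoly_of_le P (Nat.le_add_left k n)]

theorem oppositeInitial_ne_zero (hP : IsTame P)
    (hacc : IsFinRatAccumulating (oppositePoly P) h) (e : ZMod h) :
    oppositeInitial P h e ≠ 0 := by
  have h1 := (PowerSeries.WithPiTopology.tendsto_iff_coeff_tendsto ℂ _ _ _).1
      (tendsto_oppositeSeries hP hacc e) 1
  obtain ⟨u, v, hu, -, hb⟩ := hP
  have := neBot_atTop_inf_residueSet hacc.pos e
  have h2 : u ≤ ‖PowerSeries.coeff 1 (oppositeSeries P h e)‖ := by
    refine ge_of_tendsto h1.norm (Eventually.filter_mono inf_le_left ?_)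
    filter_upwards [(tendsto_sub_atTop_nat 1).eventually hb, eventually_ge_atTop 1] with n hn h1n
    rw [coeff_oppositePoly_of_le P h1n]
    rw [Nat.sub_add_cancel h1n] at hn
    exact hn.1
  exact norm_pos_iff.1 (hu.trans_le h2)

/-- The quotient `γₙ₋ₖ / γₙ` telescopes into successive quotients `γⱼ₋₁ / γⱼ`, each of which tends
to the initial of the class of `j`. The new factor at stage `k + 1` has `j = n - k`, of class `e -
(k + 1) + 1`. -/
theorem coeff_oppositeSeries (hP : IsTame P)
    (hacc : IsFinRatAccumulating (oppositePoly P) h) (k : ℕ) (e : ZMod h) :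
    PowerSeries.coeff k (oppositeSeries P h e) =
      ∏ i ∈ Finset.Icc 1 k, oppositeInitial P h (e - (i : ZMod h) + 1) := by
  have := neBot_atTop_inf_residueSet hacc.pos e
  have h1 : ∀ k, Tendsto (fun n => PowerSeries.coeff k (oppositePoly P n))
      (atTop ⊓ 𝓟 (residueSet h e)) (𝓝 (PowerSeries.coeff k (oppositeSeries P h e))) := fun k =>
    (PowerSeries.WithPiTopology.tendsto_iff_coeff_tendsto ℂ _ _ _).1
      (tendsto_oppositeSeries hP hacc e) k
  induction k with
  | zero =>
    refine tendsto_nhds_unique (h1 0) (tendsto_const_nhds.congr' ?_)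
    filter_upwards [Eventually.filter_mono inf_le_left hP.eventually_coeff_ne_zero] with n hn
    simp [coeff_oppositePoly_of_le P (Nat.zero_le n), hn]
  | succ k ih =>
    rw [Finset.prod_Icc_succ_top (by omega), ← ih]
    have h2 : Tendsto (fun n => PowerSeries.coeff (n - (k + 1)) P /
        PowerSeries.coeff (n - (k + 1) + 1) P) (atTop ⊓ 𝓟 (residueSet h e))
        (𝓝 (oppositeInitial P h (e - ((k + 1 : ℕ) : ZMod h) + 1))) := by
      have h3 := ((tendsto_coeff_div_sub hP hacc 1).comp (tendsto_sub_atTop_nat (k + 1))).mono_left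
        (inf_le_left (b := 𝓟 (residueSet h e)))
      have h4 := h3.add_const (oppositeInitial P h (e - ((k + 1 : ℕ) : ZMod h) + 1))
      rw [zero_add] at h4
      refine h4.congr' ?_
      filter_upwards [mem_inf_of_right (mem_principal_self _),
        mem_inf_of_left (eventually_ge_atTop (k + 1))] with n hn hk
      have : ((n - (k + 1) + 1 : ℕ) : ZMod h) = e - ((k + 1 : ℕ) : ZMod h) + 1 := by
        rw [Nat.cast_add, Nat.cast_sub hk, show (n : ZMod h) = e from hn, Nat.cast_one]
      simp only [Function.comp_apply, this]
      simp [oppositeInitial]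
    refine tendsto_nhds_unique (h1 (k + 1)) (((h1 k).mul h2).congr' ?_)
    have hne : ∀ᶠ n in atTop, PowerSeries.coeff (n - k) P ≠ 0 :=
      (tendsto_sub_atTop_nat k).eventually hP.eventually_coeff_ne_zero
    filter_upwards [mem_inf_of_left (eventually_ge_atTop (k + 1)), mem_inf_of_left hne] with n hk hn
    rw [coeff_oppositePoly_of_le P (show k ≤ n by omega), coeff_oppositePoly_of_le P hk,
      show n - (k + 1) + 1 = n - k by omega]
    rw [mul_comm, div_mul_div_cancel₀ hn]

end

/-! ### The radius of convergence -/

theorem IsTame.exists_norm_coeff_bounds {P : PowerSeries ℂ} (hP : IsTame P) :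
    ∃ (u v c C : ℝ) (N : ℕ), 0 < u ∧ 0 < v ∧ 0 < c ∧ ∀ n,
      ‖PowerSeries.coeff (N + n) P‖ * u ^ n ≤ C ∧ c ≤ ‖PowerSeries.coeff (N + n) P‖ * v ^ n := by
  obtain ⟨N, hN⟩ := (hP.eventually_coeff_ne_zero).exists_forall_of_atTop
  obtain ⟨u, v, hu, hv, hb⟩ := hP
  obtain ⟨M, hM⟩ := hb.exists_forall_of_atTop
  set L := max N M with hL
  have hne : ∀ n, 0 < ‖PowerSeries.coeff (L + n) P‖ := fun n =>
    norm_pos_iff.2 (hN _ ((le_max_left _ _).trans (Nat.le_add_right _ _)))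
  have hb' : ∀ n, u * ‖PowerSeries.coeff (L + (n + 1)) P‖ ≤ ‖PowerSeries.coeff (L + n) P‖ ∧
      ‖PowerSeries.coeff (L + n) P‖ ≤ v * ‖PowerSeries.coeff (L + (n + 1)) P‖ := by
    intro n
    have := hM (L + n) ((le_max_right _ _).trans (Nat.le_add_right _ _))
    rw [norm_div] at this
    exact ⟨(le_div_iff₀ (hne (n + 1))).1 this.1, (div_le_iff₀ (hne (n + 1))).1 this.2⟩
  refine ⟨u, v, ‖PowerSeries.coeff L P‖, ‖PowerSeries.coeff L P‖, L, hu, hv, hne 0, fun n => ?_⟩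
  induction n with
  | zero => simp
  | succ n ih =>
    constructor
    · refine le_trans ?_ ih.1
      rw [pow_succ', ← mul_assoc, mul_comm _ u]
      exact mul_le_mul_of_nonneg_right (hb' n).1 (by positivity)
    · refine ih.2.trans ?_
      rw [pow_succ', ← mul_assoc, mul_comm _ v]
      exact mul_le_mul_of_nonneg_right (hb' n).2 (by positivity)

/-- The geometric bounds place the radius between `u` and `v`, so `toReal` loses nothing. -/
theorem IsTame.convRadius_spec {P : PowerSeries ℂ} (hP : IsTame P) :
    0 < convRadius P ∧
      ENNReal.ofReal (convRadius P) =
        (FormalMultilinearSeries.ofScalars ℂ fun n => PowerSeries.coeff n P).radius := by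
  obtain ⟨u, v, c, C, N, hu, hv, hc, hb⟩ := hP.exists_norm_coeff_bounds
  set p := FormalMultilinearSeries.ofScalars ℂ fun n => PowerSeries.coeff n P with hp
  have hnorm : ∀ n, ‖p n‖ = ‖PowerSeries.coeff n P‖ := fun n =>
    FormalMultilinearSeries.ofScalars_norm ℂ _ n
  have hle : p.radius ≤ ENNReal.ofReal v := by
    by_contra! hlt
    have hlt' : ((v.toNNReal : NNReal) : ENNReal) < p.radius := hlt
    have ht : Tendsto (fun n => ‖p n‖ * v ^ n) atTop (𝓝 0) := by
      have := (p.summable_norm_mul_pow hlt').tendsto_atTop_zero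
      simpa [hv.le] using this
    have ht' := ht.comp (tendsto_add_atTop_nat N)
    have : c * v ^ N ≤ 0 := by
      refine ge_of_tendsto' ht' fun n => ?_
      simp only [Function.comp_apply, hnorm]
      rw [add_comm n N, pow_add, mul_left_comm, mul_comm c]
      exact mul_le_mul_of_nonneg_left (hb n).2 (by positivity)
    have : 0 < c * v ^ N := by positivity
    linarith
  have hge : ENNReal.ofReal u ≤ p.radius := by
    have hbdd : BddAbove (Set.range fun n => ‖p n‖ * u ^ n) := by
      refine IsBoundedUnder.bddAbove_range ⟨u ^ N * C, ?_⟩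
      rw [eventually_map]
      filter_upwards [eventually_ge_atTop N] with n hn
      obtain ⟨m, rfl⟩ := Nat.exists_eq_add_of_le hn
      rw [hnorm, pow_add, mul_left_comm]
      exact mul_le_mul_of_nonneg_left (hb m).1 (by positivity)
    obtain ⟨D, hD⟩ := hbdd
    refine p.le_radius_of_bound D (r := u.toNNReal) fun n => ?_
    rw [Real.coe_toNNReal u hu.le]
    exact hD ⟨n, rfl⟩
  have htop : p.radius ≠ ⊤ := ne_top_of_le_ne_top ENNReal.ofReal_ne_top hle
  have h0 : p.radius ≠ 0 := fun h0 => by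
    rw [h0, nonpos_iff_eq_zero, ENNReal.ofReal_eq_zero] at hge
    linarith
  exact ⟨ENNReal.toReal_pos h0 htop, ENNReal.ofReal_toReal htop⟩

/-! ### Meromorphic extensions -/

section

variable {r : ℝ} {P : PowerSeries ℂ} {f g : ℂ → ℂ}

theorem IsMeromorphicExtension.meromorphicAt (hf : IsMeromorphicExtension r P f) {x : ℂ}
    (hx : ‖x‖ ≤ r) : MeromorphicAt f x := by
  obtain ⟨-, U, -, hU, hm⟩ := hf
  exact hm x (hU (by simpa using hx))

theorem IsMeromorphicExtension.hasFPowerSeriesOnBall (hr : 0 < r)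
    (hf : IsMeromorphicExtension r P f) :
    HasFPowerSeriesOnBall f (FormalMultilinearSeries.ofScalars ℂ fun n => PowerSeries.coeff n P)
      0 (ENNReal.ofReal r) := by
  refine ⟨ENNReal.le_of_forall_nnreal_lt fun ρ hρ => ?_, by simpa using hr, fun {y} hy => ?_⟩
  · have hρ' : (ρ : ℝ) < r := by
      rw [← ENNReal.ofReal_coe_nnreal] at hρ
      exact (ENNReal.ofReal_lt_ofReal_iff hr).1 hρ
    have hs := (hf.1 ((ρ : ℝ) : ℂ) (by simpa using hρ')).summable.tendsto_atTop_zero.norm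
    refine FormalMultilinearSeries.le_radius_of_tendsto _ (l := 0) ?_
    simpa using hs
  · have hy' : y ∈ Metric.ball (0 : ℂ) r := by
      rwa [Metric.eball_ofReal] at hy
    simpa [FormalMultilinearSeries.ofScalars_apply_eq, mul_comm] using hf.1 y hy'

theorem IsMeromorphicExtension.analyticAt (hr : 0 < r) (hf : IsMeromorphicExtension r P f) {x : ℂ}
    (hx : ‖x‖ < r) : AnalyticAt ℂ f x := by
  refine (hf.hasFPowerSeriesOnBall hr).analyticAt_of_mem ?_
  rw [Metric.eball_ofReal]
  simpa using hx

theorem neBot_nhdsWithin_ball_of_norm_eq (hr : 0 < r) {x : ℂ} (hx : ‖x‖ = r) :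
    (𝓝[Metric.ball 0 r] x).NeBot := by
  rw [← mem_closure_iff_nhdsWithin_neBot, closure_ball 0 hr.ne']
  simp [hx]

theorem nhdsWithin_ball_le_of_norm_eq {x : ℂ} (hx : ‖x‖ = r) :
    𝓝[Metric.ball 0 r] x ≤ 𝓝[≠] x := by
  refine nhdsWithin_mono _ fun z hz hzx => ?_
  rw [Set.mem_singleton_iff.1 hzx, mem_ball_zero_iff, hx] at hz
  exact lt_irrefl _ hz

/-- The open disc accumulates at `x`, and meromorphic functions that agree frequently near `x` agree
on a punctured neighbourhood. -/
theorem IsMeromorphicExtension.eventuallyEq (hr : 0 < r) (hf : IsMeromorphicExtension r P f)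
    (hg : IsMeromorphicExtension r P g) {x : ℂ} (hx : ‖x‖ = r) : f =ᶠ[𝓝[≠] x] g := by
  have := neBot_nhdsWithin_ball_of_norm_eq hr hx
  rw [← (hf.meromorphicAt hx.le).frequently_eq_iff_eventuallyEq (hg.meromorphicAt hx.le)]
  refine Frequently.filter_mono (Eventually.frequently ?_) (nhdsWithin_ball_le_of_norm_eq hx)
  filter_upwards [self_mem_nhdsWithin] with z hz
  exact (hf.1 z hz).unique (hg.1 z hz)

theorem MemMeromorphicClass.isMeromorphicExtension (hP : MemMeromorphicClass r P) :
    IsMeromorphicExtension r P (meromorphicExtension r P) := by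
  rw [meromorphicExtension, dif_pos hP]
  exact hP.choose_spec

/-- If the extension has no poles on the circle `|t| = r`, then `P` converges on a larger disc. -/
theorem IsMeromorphicExtension.lt_radius (hr : 0 < r) (hf : IsMeromorphicExtension r P f)
    (h0 : ∀ x : ℂ, ‖x‖ = r → 0 ≤ meromorphicOrderAt f x) :
    ENNReal.ofReal r <
      (FormalMultilinearSeries.ofScalars ℂ fun n => PowerSeries.coeff n P).radius := by
  obtain ⟨-, U, hU, hsub, hm⟩ := id hf
  -- The normal form fills in removable singularities: nonnegative order becomes analyticity.
  set F := toMeromorphicNFOn f U with hF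
  have hFan : ∀ x ∈ Metric.closedBall (0 : ℂ) r, AnalyticAt ℂ F x := by
    intro x hx
    refine ((meromorphicNFOn_toMeromorphicNFOn f U
      (hsub hx)).meromorphicOrderAt_nonneg_iff_analyticAt).1 ?_
    rw [meromorphicOrderAt_toMeromorphicNFOn hm (hsub hx)]
    rcases lt_or_eq_of_le (mem_closedBall_zero_iff.1 hx) with h | h
    · exact (hf.analyticAt hr h).meromorphicOrderAt_nonneg
    · exact h0 x h
  -- By compactness `F` is analytic on a strictly larger disc. Its Taylor series there is that of
  -- `f` at `0`, hence `P`.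
  obtain ⟨δ, hδ, hth⟩ := (isCompact_closedBall (0 : ℂ) r).exists_thickening_subset_open
    (isOpen_analyticAt ℂ F) hFan
  rw [thickening_closedBall hδ hr.le] at hth
  set R : NNReal := (r + δ / 2).toNNReal with hR
  have hRr : (R : ℝ) = r + δ / 2 := Real.coe_toNNReal _ (by positivity)
  have hdiff : DifferentiableOn ℂ F (Metric.closedBall 0 R) := by
    intro x hx
    refine (hth ?_ : AnalyticAt ℂ F x).differentiableAt.differentiableWithinAt
    rw [mem_closedBall_zero_iff, hRr] at hx
    rw [mem_ball_zero_iff]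
    linarith
  have hR0 : 0 < R := by rw [← NNReal.coe_pos, hRr]; positivity
  have hps := hdiff.hasFPowerSeriesOnBall hR0
  have h00 : (0 : ℂ) ∈ Metric.closedBall (0 : ℂ) r := by simp [hr.le]
  have heq : F =ᶠ[𝓝 0] f := by
    rw [EventuallyEq, ← (hFan 0 h00).frequently_eq_iff_eventually_eq
      (hf.analyticAt hr (by simpa using hr))]
    exact (hm.toMeromorphicNFOn_eq_self_on_nhdsNE (hsub h00)).frequently
  have hser := (hps.hasFPowerSeriesAt.congr heq).eq_formalMultilinearSeries
    (hf.hasFPowerSeriesOnBall hr).hasFPowerSeriesAt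
  rw [← hser]
  refine lt_of_lt_of_le ?_ hps.r_le
  rw [← ENNReal.ofReal_coe_nnreal, hRr]
  exact (ENNReal.ofReal_lt_ofReal_iff (by positivity)).2 (by linarith)

theorem IsMeromorphicExtension.finite_poles (hf : IsMeromorphicExtension r P f) :
    {x : ℂ | ‖x‖ = r ∧ meromorphicOrderAt f x < 0}.Finite := by
  have hm : MeromorphicOn f (Metric.sphere (0 : ℂ) r) := fun x hx =>
    hf.meromorphicAt (mem_sphere_zero_iff_norm.1 hx).le
  refine ((MeromorphicOn.divisor f (Metric.sphere (0 : ℂ) r)).finiteSupport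
    (isCompact_sphere 0 r)).subset ?_
  rintro x ⟨hx, hneg⟩
  rw [Function.mem_support, MeromorphicOn.divisor_apply hm (by simpa using hx)]
  intro h
  rcases WithTop.untop₀_eq_zero.1 h with h | h <;> simp [h] at hneg

end

/-! ### Leading coefficients at poles -/

theorem meromorphicOrderAt_one_sub_div_pow_mul {f : ℂ → ℂ} {x : ℂ} (hf : MeromorphicAt f x)
    (hx : x ≠ 0) (m : ℕ) :
    meromorphicOrderAt (fun z => (1 - z / x) ^ m * f z) x = m + meromorphicOrderAt f x := by
  have h1 : meromorphicOrderAt (fun z : ℂ => (1 - z / x) ^ m) x = m := by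
    have : MeromorphicAt (fun z : ℂ => (1 - z / x) ^ m) x := by fun_prop
    have h2 := (meromorphicOrderAt_eq_int_iff (n := (m : ℤ)) this).2
      ⟨fun _ => (-x⁻¹) ^ m, by fun_prop, by simp [hx], Eventually.of_forall fun z => by
        rw [zpow_natCast, smul_eq_mul, ← mul_pow]
        congr 1
        field_simp
        ring⟩
    exact_mod_cast h2
  rw [← h1]
  exact meromorphicOrderAt_mul (by fun_prop) hf

theorem meromorphicAt_one_sub_div_pow_mul {f : ℂ → ℂ} {x : ℂ} (hf : MeromorphicAt f x) (m : ℕ) :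
    MeromorphicAt (fun z => (1 - z / x) ^ m * f z) x := by
  have : MeromorphicAt (fun z : ℂ => (1 - z / x) ^ m) x := by fun_prop
  exact this.mul hf

theorem tendsto_one_sub_div_pow_succ {x : ℂ} (hx : x ≠ 0) (m : ℕ) :
    Tendsto (fun z : ℂ => (1 - z / x) ^ (m + 1)) (𝓝[≠] x) (𝓝 0) := by
  have : ContinuousAt (fun z : ℂ => (1 - z / x) ^ (m + 1)) x := by fun_prop
  have h := this.tendsto
  simp only [div_self hx, sub_self, zero_pow (Nat.succ_ne_zero m)] at h
  exact h.mono_left nhdsWithin_le_nhds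

theorem meromorphicOrderAt_neg_of_tendsto_ne_zero {f : ℂ → ℂ} {x c : ℂ} (hf : MeromorphicAt f x)
    (hx : x ≠ 0) {m : ℕ} (hc : c ≠ 0)
    (h : Tendsto (fun z => (1 - z / x) ^ (m + 1) * f z) (𝓝[≠] x) (𝓝 c)) :
    meromorphicOrderAt f x < 0 := by
  by_contra! h0
  obtain ⟨d, hd⟩ := tendsto_nhds_of_meromorphicOrderAt_nonneg hf h0
  have := (tendsto_one_sub_div_pow_succ hx m).mul hd
  rw [zero_mul] at this
  exact hc (tendsto_nhds_unique h this)

/-- Orders are integers or infinite: if `m + 1 + ord` is positive, then `m + ord` is nonnegative. -/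
theorem exists_tendsto_one_sub_div_pow {f : ℂ → ℂ} {x : ℂ} (hf : MeromorphicAt f x)
    (hx : x ≠ 0) {m : ℕ} (h : Tendsto (fun z => (1 - z / x) ^ (m + 1) * f z) (𝓝[≠] x) (𝓝 0)) :
    ∃ c, Tendsto (fun z => (1 - z / x) ^ m * f z) (𝓝[≠] x) (𝓝 c) := by
  rw [tendsto_zero_iff_meromorphicOrderAt_pos (meromorphicAt_one_sub_div_pow_mul hf _),
    meromorphicOrderAt_one_sub_div_pow_mul hf hx] at h
  rw [tendsto_nhds_iff_meromorphicOrderAt_nonneg (meromorphicAt_one_sub_div_pow_mul hf _),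
    meromorphicOrderAt_one_sub_div_pow_mul hf hx]
  generalize meromorphicOrderAt f x = o at h ⊢
  induction o with
  | top => simp
  | coe o =>
    have h' : (0 : ℤ) < ((m + 1 : ℕ) : ℤ) + o := by exact_mod_cast h
    have : (0 : ℤ) ≤ (m : ℤ) + o := by push_cast at h'; omega
    exact_mod_cast this

/-! ### Asymptotics of coefficients -/

section

variable {r : ℝ}

theorem hasSum_choose_mul_inv_pow {x z : ℂ} (hxz : ‖z‖ < ‖x‖) (m : ℕ) :
    HasSum (fun n : ℕ => ((n + m).choose m : ℂ) * x⁻¹ ^ n * z ^ n) ((1 - z / x) ^ (m + 1))⁻¹ := by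
  have hlt : ‖z / x‖ < 1 := by
    rw [norm_div]
    exact (div_lt_one ((norm_nonneg z).trans_lt hxz)).2 hxz
  have := hasSum_choose_mul_geometric_of_norm_lt_one m hlt
  rw [one_div] at this
  refine this.congr_fun fun n => ?_
  rw [div_pow, inv_pow]
  ring

/-- Subtracting `∑ c x (1 - z/x)^(-(m+1))`, whose coefficients are explicit, leaves a function with
poles of order at most `m` on the circle. The growth hypothesis `hm` disposes of it. Stating `hm`
separately lets this serve as the inductive step for `tendsto_coeff_div_choose`. -/
theorem IsMeromorphicExtension.tendsto_coeff_sub_of_growth (hr : 0 < r) {m : ℕ}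
    (hm : ∀ (P : PowerSeries ℂ) (f : ℂ → ℂ), IsMeromorphicExtension r P f →
      (∀ x : ℂ, ‖x‖ = r → ∃ c, Tendsto (fun z => (1 - z / x) ^ m * f z) (𝓝[≠] x) (𝓝 c)) →
      Tendsto (fun n => PowerSeries.coeff n P * r ^ n / ((n + m).choose m : ℂ)) atTop (𝓝 0))
    {P : PowerSeries ℂ} {f : ℂ → ℂ} (hf : IsMeromorphicExtension r P f) {S : Finset ℂ} {c : ℂ → ℂ}
    (hS : ∀ x, x ∈ S ↔ ‖x‖ = r ∧ c x ≠ 0)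
    (hc : ∀ x : ℂ, ‖x‖ = r →
      Tendsto (fun z => (1 - z / x) ^ (m + 1) * f z) (𝓝[≠] x) (𝓝 (c x))) :
    Tendsto (fun n => PowerSeries.coeff n P * r ^ n / ((n + m).choose m : ℂ) -
      ∑ x ∈ S, c x * (r / x) ^ n) atTop (𝓝 0) := by
  have hSr : ∀ x ∈ S, ‖x‖ = r := fun x hx => ((hS x).1 hx).1
  have hne : ∀ x : ℂ, ‖x‖ = r → x ≠ 0 := fun x hx => norm_pos_iff.1 (hx ▸ hr)
  set Q : PowerSeries ℂ := PowerSeries.mk fun n => PowerSeries.coeff n P -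
    ∑ x ∈ S, c x * (((n + m).choose m : ℂ) * x⁻¹ ^ n) with hQ
  set q : ℂ → ℂ := fun z => f z - ∑ x ∈ S, c x * ((1 - z / x) ^ (m + 1))⁻¹ with hq
  have hmer : ∀ y, MeromorphicAt (fun z => ∑ x ∈ S, c x * ((1 - z / x) ^ (m + 1))⁻¹) y := by
    intro y
    refine MeromorphicAt.fun_sum fun x _ => ?_
    fun_prop
  have hext : IsMeromorphicExtension r Q q := by
    refine ⟨fun z hz => ?_, ?_⟩
    · have h1 : HasSum (fun n : ℕ => ∑ x ∈ S, c x * (((n + m).choose m : ℂ) * x⁻¹ ^ n * z ^ n))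
          (∑ x ∈ S, c x * ((1 - z / x) ^ (m + 1))⁻¹) := by
        refine hasSum_sum fun x hx => (hasSum_choose_mul_inv_pow ?_ m).mul_left (c x)
        rw [hSr x hx]
        simpa using hz
      refine ((hf.1 z hz).sub h1).congr_fun fun n => ?_
      rw [hQ, PowerSeries.coeff_mk, sub_mul, Finset.sum_mul]
      simp only [mul_assoc]
    · obtain ⟨-, U, hU, hsub, hmU⟩ := hf
      exact ⟨U, hU, hsub, fun y hy => (hmU y hy).sub (hmer y)⟩
  have hlow : ∀ y : ℂ, ‖y‖ = r →
      ∃ c, Tendsto (fun z => (1 - z / y) ^ m * q z) (𝓝[≠] y) (𝓝 c) := by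
    intro y hy
    refine exists_tendsto_one_sub_div_pow (hext.meromorphicAt hy.le) (hne y hy) ?_
    have h1 : ∀ x ∈ S, Tendsto (fun z => (1 - z / y) ^ (m + 1) * (c x * ((1 - z / x) ^ (m + 1))⁻¹))
        (𝓝[≠] y) (𝓝 (if x = y then c y else 0)) := by
      intro x hx
      split_ifs with hxy
      · subst hxy
        refine tendsto_const_nhds.congr' ?_
        filter_upwards [self_mem_nhdsWithin] with z hz
        have : (1 - z / x) ^ (m + 1) ≠ 0 := by
          refine pow_ne_zero _ (sub_ne_zero.2 fun h => hz ?_)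
          rw [eq_comm, div_eq_one_iff_eq (hne x hy)] at h
          exact h
        field_simp
      · have h2 : Tendsto (fun z => c x * ((1 - z / x) ^ (m + 1))⁻¹) (𝓝[≠] y)
            (𝓝 (c x * ((1 - y / x) ^ (m + 1))⁻¹)) := by
          have : (1 - y / x) ^ (m + 1) ≠ 0 := by
            refine pow_ne_zero _ (sub_ne_zero.2 fun h => hxy ?_)
            rw [eq_comm, div_eq_one_iff_eq (hne x (hSr x hx))] at h
            exact h.symm
          have hcont : ContinuousAt (fun z => c x * ((1 - z / x) ^ (m + 1))⁻¹) y := by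
            fun_prop (disch := assumption)
          exact hcont.tendsto.mono_left nhdsWithin_le_nhds
        have := (tendsto_one_sub_div_pow_succ (hne y hy) m).mul h2
        rwa [zero_mul] at this
    have h3 := (hc y hy).sub (tendsto_finsetSum S h1)
    have h4 : c y - ∑ x ∈ S, (if x = y then c y else 0) = 0 := by
      rw [Finset.sum_ite_eq']
      split_ifs with hyS
      · exact sub_self _
      · rw [sub_zero]
        by_contra hcy
        exact hyS ((hS y).2 ⟨hy, hcy⟩)
    rw [h4] at h3
    refine h3.congr fun z => ?_
    rw [hq, mul_sub, Finset.mul_sum]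
  refine (hm Q q hext hlow).congr fun n => ?_
  have hchoose : ((n + m).choose m : ℂ) ≠ 0 :=
    Nat.cast_ne_zero.2 (Nat.choose_pos (Nat.le_add_left m n)).ne'
  rw [hQ, PowerSeries.coeff_mk, sub_mul, sub_div, Finset.sum_mul, Finset.sum_div]
  congr 1
  refine Finset.sum_congr rfl fun x _ => ?_
  rw [div_pow, inv_pow, div_eq_mul_inv (_ ^ n)]
  field_simp

theorem norm_sum_mul_pow_le (hr : 0 < r) {S : Finset ℂ} (hS : ∀ x ∈ S, ‖x‖ = r) (c : ℂ → ℂ)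
    (n : ℕ) : ‖∑ x ∈ S, c x * (r / x) ^ n‖ ≤ ∑ x ∈ S, ‖c x‖ := by
  refine (norm_sum_le _ _).trans (Finset.sum_le_sum fun x hx => ?_)
  rw [norm_mul, norm_pow, norm_div, hS x hx, Complex.norm_of_nonneg hr.le, div_self hr.ne',
    one_pow, mul_one]

theorem IsMeromorphicExtension.exists_finset (hr : 0 < r) {m : ℕ} {P : PowerSeries ℂ} {f : ℂ → ℂ}
    (hf : IsMeromorphicExtension r P f) {c : ℂ → ℂ} (hc : ∀ x : ℂ, ‖x‖ = r →
      Tendsto (fun z => (1 - z / x) ^ (m + 1) * f z) (𝓝[≠] x) (𝓝 (c x))) :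
    ∃ S : Finset ℂ, ∀ x, x ∈ S ↔ ‖x‖ = r ∧ c x ≠ 0 := by
  have hfin : {x : ℂ | ‖x‖ = r ∧ c x ≠ 0}.Finite :=
    hf.finite_poles.subset fun x hx => ⟨hx.1, meromorphicOrderAt_neg_of_tendsto_ne_zero
      (hf.meromorphicAt hx.1.le) (norm_pos_iff.1 (hx.1 ▸ hr)) hx.2 (hc x hx.1)⟩
  exact ⟨hfin.toFinset, fun x => by simp⟩

theorem tendsto_choose_div_choose_succ (m : ℕ) :
    Tendsto (fun n : ℕ => ((n + m).choose m : ℂ) / ((n + (m + 1)).choose (m + 1) : ℂ)) atTop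
      (𝓝 0) := by
  have h1 : Tendsto (fun n : ℕ => ((m + 1 : ℕ) : ℂ) / ((n + (m + 1) : ℕ) : ℂ)) atTop (𝓝 0) :=
    (tendsto_const_div_atTop_nhds_zero_nat ((m + 1 : ℕ) : ℂ)).comp (tendsto_add_atTop_nat (m + 1))
  refine h1.congr fun n => ?_
  have h2 : ((n + (m + 1)).choose (m + 1) : ℂ) ≠ 0 :=
    Nat.cast_ne_zero.2 (Nat.choose_pos (Nat.le_add_left _ n)).ne'
  have h3 : ((n + (m + 1) : ℕ) : ℂ) ≠ 0 := Nat.cast_ne_zero.2 (by omega)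
  rw [div_eq_div_iff h3 h2]
  have := Nat.add_one_mul_choose_eq (n + m) m
  rw [mul_comm, mul_comm ((n + m).choose m : ℂ)]
  exact_mod_cast this.symm

/-- Poles of order at most `m` give coefficients `o(C(n+m, m) r⁻ⁿ)`. Without poles the radius
exceeds `r`. In the inductive step the expansion shows that division by `C(n+m, m)` leaves a bounded
sequence, and the next binomial is of larger growth. -/
theorem IsMeromorphicExtension.tendsto_coeff_div_choose (hr : 0 < r) (m : ℕ) :
    ∀ (P : PowerSeries ℂ) (f : ℂ → ℂ), IsMeromorphicExtension r P f →
      (∀ x : ℂ, ‖x‖ = r → ∃ c, Tendsto (fun z => (1 - z / x) ^ m * f z) (𝓝[≠] x) (𝓝 c)) →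
      Tendsto (fun n => PowerSeries.coeff n P * r ^ n / ((n + m).choose m : ℂ)) atTop (𝓝 0) := by
  induction m with
  | zero =>
    intro P f hf hlim
    have hlt : ((r.toNNReal : NNReal) : ENNReal) <
        (FormalMultilinearSeries.ofScalars ℂ fun n => PowerSeries.coeff n P).radius := by
      refine hf.lt_radius hr fun x hx => ?_
      obtain ⟨c, hc⟩ := hlim x hx
      simp only [pow_zero, one_mul] at hc
      exact (tendsto_nhds_iff_meromorphicOrderAt_nonneg (hf.meromorphicAt hx.le)).1 ⟨c, hc⟩
    have := (FormalMultilinearSeries.summable_norm_mul_pow _ hlt).tendsto_atTop_zero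
    rw [tendsto_zero_iff_norm_tendsto_zero]
    simpa [FormalMultilinearSeries.ofScalars_norm, hr.le, abs_of_pos hr] using this
  | succ m ih =>
    intro P f hf hlim
    have : ∀ x : ℂ, ∃ c, ‖x‖ = r →
        Tendsto (fun z => (1 - z / x) ^ (m + 1) * f z) (𝓝[≠] x) (𝓝 c) := fun x => by
      by_cases hx : ‖x‖ = r
      · exact (hlim x hx).imp fun c hc _ => hc
      · exact ⟨0, fun h => absurd h hx⟩
    choose c hc using this
    obtain ⟨S, hS⟩ := hf.exists_finset hr hc
    have h1 := hf.tendsto_coeff_sub_of_growth hr ih hS hc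
    have h3 := h1.norm
    rw [norm_zero] at h3
    have h2 : IsBoundedUnder (· ≤ ·) atTop fun n : ℕ =>
        ‖PowerSeries.coeff n P * r ^ n / ((n + m).choose m : ℂ)‖ := by
      have hb : IsBoundedUnder (· ≤ ·) atTop fun n : ℕ => ‖∑ x ∈ S, c x * (r / x) ^ n‖ :=
        ⟨_, eventually_map.2 (Eventually.of_forall
          (norm_sum_mul_pow_le hr (fun x hx => ((hS x).1 hx).1) c))⟩
      obtain ⟨B, hB⟩ := hb
      rw [eventually_map] at hB
      refine ⟨1 + B, ?_⟩
      rw [eventually_map]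
      filter_upwards [hB, h3.eventually_le_const one_pos] with n hn1 hn2
      refine le_trans ?_ (add_le_add hn2 hn1)
      simpa using norm_add_le (PowerSeries.coeff n P * r ^ n / ((n + m).choose m : ℂ) -
        ∑ x ∈ S, c x * (r / x) ^ n) (∑ x ∈ S, c x * (r / x) ^ n)
    refine ((tendsto_choose_div_choose_succ m).zero_mul_isBoundedUnder_le h2).congr fun n => ?_
    have hchoose : ((n + m).choose m : ℂ) ≠ 0 :=
      Nat.cast_ne_zero.2 (Nat.choose_pos (Nat.le_add_left m n)).ne'
    rw [mul_comm, div_mul_div_cancel₀ hchoose]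

theorem IsMeromorphicExtension.tendsto_coeff_sub (hr : 0 < r) {m : ℕ}
    {P : PowerSeries ℂ} {f : ℂ → ℂ} (hf : IsMeromorphicExtension r P f) {S : Finset ℂ} {c : ℂ → ℂ}
    (hS : ∀ x, x ∈ S ↔ ‖x‖ = r ∧ c x ≠ 0)
    (hc : ∀ x : ℂ, ‖x‖ = r →
      Tendsto (fun z => (1 - z / x) ^ (m + 1) * f z) (𝓝[≠] x) (𝓝 (c x))) :
    Tendsto (fun n => PowerSeries.coeff n P * r ^ n / ((n + m).choose m : ℂ) -
      ∑ x ∈ S, c x * (r / x) ^ n) atTop (𝓝 0) :=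
  hf.tendsto_coeff_sub_of_growth hr (tendsto_coeff_div_choose hr m) hS hc

end

/-! ### Sums of powers -/

theorem sum_range_div_pow {x y : ℂ} {h : ℕ} (hx : x ≠ 0) (hxy : x ^ h = y ^ h) :
    ∑ k ∈ Finset.range h, (y / x) ^ k = if x = y then (h : ℂ) else 0 := by
  split_ifs with heq
  · simp [← heq, hx]
  · have h1 : y / x ≠ 1 := fun h => heq ((div_eq_one_iff_eq hx).1 h).symm
    rw [geom_sum_eq h1, div_pow, ← hxy, div_self (pow_ne_zero _ hx), sub_self, zero_div]

/-- Applying to the sequence the polynomial in the shift operator that is `1` at `w x` and `0` at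
the other `w y` isolates `c x (w x)ⁿ`. Its norm is constant and tends to `0`. -/
theorem eq_zero_of_tendsto_sum_mul_pow {S : Finset ℂ} {w c : ℂ → ℂ} (hw : ∀ x ∈ S, ‖w x‖ = 1)
    (hinj : Set.InjOn w S)
    (h : Tendsto (fun n : ℕ => ∑ x ∈ S, c x * w x ^ n) atTop (𝓝 0)) {x : ℂ} (hx : x ∈ S) :
    c x = 0 := by
  set p := Lagrange.basis S w x with hp
  have h1 : Tendsto (fun n : ℕ => ∑ k ∈ Finset.range (p.natDegree + 1),
      p.coeff k * ∑ y ∈ S, c y * w y ^ (n + k)) atTop (𝓝 0) := by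
    have := tendsto_finsetSum (Finset.range (p.natDegree + 1)) fun k _ =>
      (h.comp (tendsto_add_atTop_nat k)).const_mul (p.coeff k)
    simpa using this
  have h2 : ∀ n : ℕ, ∑ k ∈ Finset.range (p.natDegree + 1),
      p.coeff k * ∑ y ∈ S, c y * w y ^ (n + k) = c x * w x ^ n := by
    intro n
    simp only [Finset.mul_sum]
    rw [Finset.sum_comm, Finset.sum_eq_single_of_mem x hx]
    · have h3 := p.eval_eq_sum_range (w x)
      rw [hp, Lagrange.eval_basis_self hinj hx] at h3
      rw [← mul_one (c x * _), h3, Finset.mul_sum]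
      exact Finset.sum_congr rfl fun k _ => by rw [pow_add]; ring
    · intro y hy hyx
      have h3 := p.eval_eq_sum_range (w y)
      rw [hp, Lagrange.eval_basis_of_ne hyx.symm hy] at h3
      rw [← mul_zero (c y * w y ^ n), h3, Finset.mul_sum]
      exact Finset.sum_congr rfl fun k _ => by rw [pow_add]; ring
  have h3 := h1.norm
  simp only [h2, norm_mul, norm_pow, hw x hx, one_pow, mul_one, norm_zero] at h3
  exact norm_eq_zero.1 (tendsto_nhds_unique tendsto_const_nhds h3)

theorem tendsto_choose_add_div_choose (m k : ℕ) :
    Tendsto (fun n : ℕ => ((n + k + m).choose m : ℂ) / ((n + m).choose m : ℂ)) atTop (𝓝 1) := by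
  have hne : ∀ n : ℕ, ((n + m).choose m : ℂ) ≠ 0 := fun n =>
    Nat.cast_ne_zero.2 (Nat.choose_pos (Nat.le_add_left m n)).ne'
  have h1 : Tendsto (fun n : ℕ => ((n + 1 + m).choose m : ℂ) / ((n + m).choose m : ℂ)) atTop
      (𝓝 1) := by
    have h2 : Tendsto (fun n : ℕ => 1 + (m : ℂ) / ((n + 1 : ℕ) : ℂ)) atTop (𝓝 (1 + 0)) :=
      ((tendsto_const_div_atTop_nhds_zero_nat (m : ℂ)).comp (tendsto_add_atTop_nat 1)).const_add 1
    rw [add_zero] at h2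
    refine h2.congr fun n => ?_
    have h3 : ((n + 1 : ℕ) : ℂ) ≠ 0 := Nat.cast_ne_zero.2 (by omega)
    have h4 := Nat.choose_mul_succ_eq (n + m) m
    rw [show n + m + 1 - m = n + 1 by omega, show n + m + 1 = n + 1 + m by omega] at h4
    have h5 : ((n + m).choose m : ℂ) * ((n + 1 + m : ℕ) : ℂ) =
        ((n + 1 + m).choose m : ℂ) * ((n + 1 : ℕ) : ℂ) := by exact_mod_cast h4
    rw [eq_div_iff (hne n), one_add_div h3, div_mul_eq_mul_div, div_eq_iff h3, ← h5]
    push_cast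
    ring
  induction k with
  | zero => simp [hne]
  | succ k ih =>
    have := (h1.comp (tendsto_add_atTop_nat k)).mul ih
    rw [one_mul] at this
    refine this.congr fun n => ?_
    simp only [Function.comp_apply]
    rw [div_mul_div_cancel₀ (hne _), add_assoc n k 1]

/-! ### Comparison of the leading term with the opposite series -/

/-- With `y n = γₙ rⁿ / C(n+m, m)`, the identity `y n = r⁻ᵏ (γₙ / γₙ₊ₖ) q n y (n+k)` is exact. Here
`q → 1`, `γₙ / γₙ₊ₖ` is close to `β n` and `y` to `H`; boundedness lets each factor be replaced. The
product form avoids dividing by `H`, which is not yet known to stay away from `0`. -/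
theorem tendsto_leading_sub {γ H β : ℕ → ℂ} {r : ℝ} {m k : ℕ} (hr : 0 < r)
    (hγ : ∀ᶠ n in atTop, γ n ≠ 0) (hβ : Tendsto (fun n => γ n / γ (n + k) - β n) atTop (𝓝 0))
    (hβb : IsBoundedUnder (· ≤ ·) atTop (norm ∘ β)) (hHb : IsBoundedUnder (· ≤ ·) atTop (norm ∘ H))
    (hH : Tendsto (fun n => γ n * r ^ n / ((n + m).choose m : ℂ) - H n) atTop (𝓝 0)) :
    Tendsto (fun n => H n - ((r : ℂ) ^ k)⁻¹ * β n * H (n + k)) atTop (𝓝 0) := by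
  have hne : ∀ n : ℕ, ((n + m).choose m : ℂ) ≠ 0 := fun n =>
    Nat.cast_ne_zero.2 (Nat.choose_pos (Nat.le_add_left m n)).ne'
  set y : ℕ → ℂ := fun n => γ n * r ^ n / ((n + m).choose m : ℂ) with hy
  set q : ℕ → ℂ := fun n => ((n + k + m).choose m : ℂ) / ((n + m).choose m : ℂ) with hq
  have hq1 : Tendsto q atTop (𝓝 1) := tendsto_choose_add_div_choose m k
  have hyb : IsBoundedUnder (· ≤ ·) atTop (norm ∘ y) := by
    obtain ⟨B, hB⟩ := hHb
    rw [eventually_map] at hB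
    have h3 := hH.norm
    rw [norm_zero] at h3
    refine ⟨1 + B, ?_⟩
    rw [eventually_map]
    filter_upwards [hB, h3.eventually_le_const one_pos] with n hn1 hn2
    refine le_trans ?_ (add_le_add hn2 hn1)
    simpa using norm_add_le (y n - H n) (H n)
  have hyk : IsBoundedUnder (· ≤ ·) atTop (norm ∘ fun n => y (n + k)) := by
    obtain ⟨B, hB⟩ := hyb
    exact ⟨B, eventually_map.2 ((tendsto_add_atTop_nat k).eventually (eventually_map.1 hB))⟩
  have hbr : Tendsto (fun n => (γ n / γ (n + k) - β n) * q n + (q n - 1) * β n) atTop (𝓝 0) := by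
    have h1 := hβ.mul hq1
    have h2 : Tendsto (fun n => q n - 1) atTop (𝓝 0) := by simpa using hq1.sub_const 1
    simpa using h1.add (h2.zero_mul_isBoundedUnder_le hβb)
  have h1 := (hbr.zero_mul_isBoundedUnder_le hyk).const_mul ((r : ℂ) ^ k)⁻¹
  have h2 := (((hH.comp (tendsto_add_atTop_nat k)).zero_mul_isBoundedUnder_le hβb).const_mul
    ((r : ℂ) ^ k)⁻¹)
  have h3 := (h1.sub hH).add h2
  rw [mul_zero, sub_zero, add_zero] at h3
  refine h3.congr' ?_
  filter_upwards [(tendsto_add_atTop_nat k).eventually hγ] with n hn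
  have hrc : (r : ℂ) ≠ 0 := by exact_mod_cast hr.ne'
  have hyn : y n = ((r : ℂ) ^ k)⁻¹ * (γ n / γ (n + k)) * q n * y (n + k) := by
    rw [hy, hq]
    have h6 := hne n
    have h7 := hne (n + k)
    simp only [pow_add]
    field_simp
  change _ * (_ * y (n + k)) - (y n - H n) + _ * ((y (n + k) - H (n + k)) * β n) = _
  rw [hyn]
  ring

/-- The exponential sum `∑ cₓ x⁻ⁿ`. -/
def expSum (S : Finset ℂ) (c : ℂ → ℂ) (n : ℕ) : ℂ := ∑ x ∈ S, c x * x⁻¹ ^ n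

theorem sum_zmod_val {M : Type*} [AddCommMonoid M] {h : ℕ} [NeZero h] (F : ℕ → M) :
    ∑ e : ZMod h, F e.val = ∑ k ∈ Finset.range h, F k :=
  Finset.sum_nbij' ZMod.val (fun k => (k : ZMod h)) (fun e _ => Finset.mem_range.2 e.val_lt)
    (fun _ _ => Finset.mem_univ _) (fun e _ => ZMod.natCast_rightInverse e)
    (fun _ hk => ZMod.val_cast_of_lt (Finset.mem_range.1 hk)) fun _ _ => rfl

theorem prod_range_natCast_zmod {M : Type*} [CommMonoid M] {h : ℕ} [NeZero h] (F : ZMod h → M) :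
    ∏ k ∈ Finset.range h, F (k : ZMod h) = ∏ e : ZMod h, F e :=
  Finset.prod_nbij' (fun k => (k : ZMod h)) ZMod.val (fun _ _ => Finset.mem_univ _)
    (fun e _ => Finset.mem_range.2 e.val_lt)
    (fun _ hk => ZMod.val_cast_of_lt (Finset.mem_range.1 hk))
    (fun e _ => ZMod.natCast_rightInverse e) fun _ _ => rfl

theorem prod_Icc_eq_cyclicProduct {h : ℕ} (hh : 0 < h) (a : ZMod h → ℂ) (e : ZMod h) :
    ∏ i ∈ Finset.Icc 1 h, a (e - (i : ZMod h) + 1) = cyclicProduct a := by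
  have : NeZero h := ⟨hh.ne'⟩
  have h1 : ∀ k : ℕ, ∏ i ∈ Finset.Icc 1 k, a (e - (i : ZMod h) + 1) =
      ∏ i ∈ Finset.range k, a (e - (i : ZMod h)) := by
    intro k
    induction k with
    | zero => simp
    | succ k ih =>
      rw [Finset.prod_Icc_succ_top (by omega), ih, Finset.prod_range_succ]
      congr 2
      push_cast
      ring
  rw [h1, cyclicProduct, prod_range_natCast_zmod fun i => a (e - i),
    prod_range_natCast_zmod fun i => a i]
  exact (Equiv.subLeft e).prod_comp a

/-- If the power series has radius of convergence `r`, then its extension has poles on `|t| = r`;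
`m + 1` is the highest order of these poles, and `c x` is the leading coefficient at `x`. -/
theorem IsMeromorphicExtension.exists_leading_coeff {r : ℝ} (hr : 0 < r) {P : PowerSeries ℂ}
    {f : ℂ → ℂ} (hf : IsMeromorphicExtension r P f) (hrad : ENNReal.ofReal r =
      (FormalMultilinearSeries.ofScalars ℂ fun n => PowerSeries.coeff n P).radius) :
    ∃ (m : ℕ) (S : Finset ℂ) (c : ℂ → ℂ), S.Nonempty ∧ (∀ x, x ∈ S ↔ ‖x‖ = r ∧ c x ≠ 0) ∧
      (∀ x : ℂ, ‖x‖ = r →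
        Tendsto (fun z => (1 - z / x) ^ (m + 1) * f z) (𝓝[≠] x) (𝓝 (c x))) ∧
      (∀ x : ℂ, ‖x‖ = r → ((-(m + 1 : ℕ) : ℤ) : WithTop ℤ) ≤ meromorphicOrderAt f x) ∧
      ∀ x, x ∈ S ↔ ‖x‖ = r ∧ meromorphicOrderAt f x = ((-(m + 1 : ℕ) : ℤ) : WithTop ℤ) := by
  have hne : ∀ x : ℂ, ‖x‖ = r → x ≠ 0 := fun x hx => norm_pos_iff.1 (hx ▸ hr)
  have hex : ∃ x : ℂ, ‖x‖ = r ∧ meromorphicOrderAt f x < 0 := by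
    by_contra! h
    exact (hf.lt_radius hr h).ne hrad
  obtain ⟨x₀, hx₀, hmin⟩ := Finset.exists_min_image hf.finite_poles.toFinset (meromorphicOrderAt f)
    (by simpa [Finset.Nonempty] using hex)
  simp only [Set.Finite.mem_toFinset, Set.mem_ofPred_eq] at hx₀ hmin
  obtain ⟨m, hm⟩ : ∃ m : ℕ, meromorphicOrderAt f x₀ = ((-(m + 1 : ℕ) : ℤ) : WithTop ℤ) := by
    have h0 := hx₀.2
    generalize meromorphicOrderAt f x₀ = o at h0
    induction o with
    | top => simp at h0
    | coe o =>
      have h' : o < 0 := by exact_mod_cast h0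
      -- The pole order `-o` is at least `1` and equals `m + 1`.
      exact ⟨(-o - 1).toNat, by congr 1; omega⟩
  have hge : ∀ x : ℂ, ‖x‖ = r → ((-(m + 1 : ℕ) : ℤ) : WithTop ℤ) ≤ meromorphicOrderAt f x := by
    intro x hx
    rw [← hm]
    rcases lt_or_ge (meromorphicOrderAt f x) 0 with h | h
    · exact hmin x ⟨hx, h⟩
    · exact hx₀.2.le.trans h
  have hcancel : (((m + 1 : ℕ) : WithTop ℤ)) + ((-(m + 1 : ℕ) : ℤ) : WithTop ℤ) = 0 := by
    have : ((m + 1 : ℕ) : ℤ) + (-(m + 1 : ℕ) : ℤ) = 0 := by ring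
    exact_mod_cast this
  have hlim : ∀ x : ℂ, ∃ c, ‖x‖ = r →
      Tendsto (fun z => (1 - z / x) ^ (m + 1) * f z) (𝓝[≠] x) (𝓝 c) := fun x => by
    by_cases hx : ‖x‖ = r
    · have hmx := hf.meromorphicAt hx.le
      have : 0 ≤ meromorphicOrderAt (fun z => (1 - z / x) ^ (m + 1) * f z) x := by
        rw [meromorphicOrderAt_one_sub_div_pow_mul hmx (hne x hx), ← hcancel]
        gcongr
        exact hge x hx
      exact (tendsto_nhds_of_meromorphicOrderAt_nonneg
        (meromorphicAt_one_sub_div_pow_mul hmx _) this).imp fun c hc _ => hc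
    · exact ⟨0, fun h => absurd h hx⟩
  choose c hc using hlim
  obtain ⟨S, hS⟩ := hf.exists_finset hr hc
  have hS' : ∀ x, x ∈ S ↔
      ‖x‖ = r ∧ meromorphicOrderAt f x = ((-(m + 1 : ℕ) : ℤ) : WithTop ℤ) := by
    intro x
    rw [hS]
    refine and_congr_right fun hx => ?_
    have hmx := hf.meromorphicAt hx.le
    have h1 := tendsto_ne_zero_iff_meromorphicOrderAt_eq_zero
      (meromorphicAt_one_sub_div_pow_mul hmx (m + 1))
    rw [meromorphicOrderAt_one_sub_div_pow_mul hmx (hne x hx)] at h1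
    constructor
    · intro hcx
      have h2 := h1.1 ⟨c x, hcx, hc x hx⟩
      generalize meromorphicOrderAt f x = o at h2 ⊢
      induction o with
      | top => simp at h2
      | coe o =>
        have h3 : ((m + 1 : ℕ) : ℤ) + o = 0 := by exact_mod_cast h2
        congr 1
        omega
    · intro ho
      obtain ⟨d, hd, hd'⟩ := h1.2 (by rw [ho, hcancel])
      rwa [tendsto_nhds_unique (hc x hx) hd']
  exact ⟨m, S, c, ⟨x₀, (hS' x₀).2 ⟨hx₀.1, hm⟩⟩, hS, hc, hge, hS'⟩

section

variable {P : PowerSeries ℂ} {h : ℕ}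

theorem pow_eq_cyclicProduct_and_recurrence (hP : IsTame P)
    (hacc : IsFinRatAccumulating (oppositePoly P) h) {r : ℝ} (hr : 0 < r) {m : ℕ} {S : Finset ℂ}
    {c : ℂ → ℂ} (hS : ∀ x ∈ S, ‖x‖ = r) (hc : ∀ x ∈ S, c x ≠ 0) (hne : S.Nonempty)
    (hH : Tendsto (fun n => PowerSeries.coeff n P * r ^ n / ((n + m).choose m : ℂ) -
      ∑ x ∈ S, c x * (r / x) ^ n) atTop (𝓝 0)) :
    (∀ x ∈ S, x ^ h = cyclicProduct (oppositeInitial P h)) ∧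
      ∀ n : ℕ, expSum S c n =
        oppositeInitial P h ((n + 1 : ℕ) : ZMod h) * expSum S c (n + 1) := by
  have : NeZero h := ⟨hacc.pos.ne'⟩
  have hrc : (r : ℂ) ≠ 0 := by exact_mod_cast hr.ne'
  have hx0 : ∀ x ∈ S, x ≠ 0 := fun x hx => norm_pos_iff.1 (hS x hx ▸ hr)
  have hHb : IsBoundedUnder (· ≤ ·) atTop (norm ∘ fun n : ℕ => ∑ x ∈ S, c x * (r / x) ^ n) :=
    ⟨_, eventually_map.2 (Eventually.of_forall (norm_sum_mul_pow_le hr hS c))⟩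
  have key : ∀ k : ℕ, Tendsto (fun n : ℕ => ∑ x ∈ S, c x * (r / x) ^ n - ((r : ℂ) ^ k)⁻¹ *
      PowerSeries.coeff k (oppositeSeries P h ((n + k : ℕ) : ZMod h)) *
        ∑ x ∈ S, c x * (r / x) ^ (n + k)) atTop (𝓝 0) := by
    intro k
    refine tendsto_leading_sub hr hP.eventually_coeff_ne_zero (tendsto_coeff_div_sub hP hacc k)
      ?_ hHb hH
    obtain ⟨B, hB⟩ := (Set.finite_range fun e : ZMod h =>
      ‖PowerSeries.coeff k (oppositeSeries P h e)‖).bddAbove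
    exact ⟨B, eventually_map.2 (Eventually.of_forall fun n => hB ⟨_, rfl⟩)⟩
  have hA : ∀ x ∈ S, x ^ h = cyclicProduct (oppositeInitial P h) := by
    set A := cyclicProduct (oppositeInitial P h) with hA
    -- For `k = h` the coefficient is a product over a full cycle, hence equal to `A` whatever the
    -- class of `n`.
    have h1 : Tendsto (fun n : ℕ => ∑ x ∈ S, (c x * (1 - A / x ^ h)) * (r / x) ^ n) atTop
        (𝓝 0) := by
      refine (key h).congr fun n => ?_
      rw [coeff_oppositeSeries hP hacc, prod_Icc_eq_cyclicProduct hacc.pos, ← hA, Finset.mul_sum,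
        ← Finset.sum_sub_distrib]
      refine Finset.sum_congr rfl fun x hx => ?_
      have := hx0 x hx
      rw [pow_add, div_pow (r : ℂ) x h]
      field_simp
    intro x hx
    have h2 := eq_zero_of_tendsto_sum_mul_pow (w := fun x => r / x) (fun x hx => by
      rw [norm_div, hS x hx, Complex.norm_of_nonneg hr.le, div_self hr.ne']) (fun x hx y hy hxy => by
        have h3 : (r : ℂ) / x = r / y := hxy
        rwa [div_eq_div_iff (hx0 x hx) (hx0 y hy), mul_right_inj' hrc, eq_comm] at h3) h1 hx
    have h3 := (mul_eq_zero.1 h2).resolve_left (hc x hx)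
    rw [sub_eq_zero, eq_comm, div_eq_one_iff_eq (pow_ne_zero _ (hx0 x hx))] at h3
    exact h3.symm
  refine ⟨hA, fun n => ?_⟩
  obtain ⟨x₀, hx₀⟩ := hne
  set A := cyclicProduct (oppositeInitial P h) with hAdef
  have hAn : ‖A‖ = r ^ h := by rw [← hA x₀ hx₀, norm_pow, hS x₀ hx₀]
  have hA0 : A ≠ 0 := by rw [← hA x₀ hx₀]; exact pow_ne_zero _ (hx0 x₀ hx₀)
  -- The defect in the recurrence. A shift by `h` multiplies it by `r^h / A`, of modulus `1`, so its
  -- norm is constant along `n + j h`; since it tends to `0`, it vanishes.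
  set D : ℕ → ℂ := fun n => ∑ x ∈ S, c x * (r / x) ^ n - ((r : ℂ) ^ 1)⁻¹ *
      PowerSeries.coeff 1 (oppositeSeries P h ((n + 1 : ℕ) : ZMod h)) *
        ∑ x ∈ S, c x * (r / x) ^ (n + 1) with hD
  have hper : ∀ n, ∑ x ∈ S, c x * (r / x) ^ (n + h) =
      (r ^ h / A) * ∑ x ∈ S, c x * (r / x) ^ n := by
    intro n
    rw [Finset.mul_sum]
    refine Finset.sum_congr rfl fun x hx => ?_
    rw [pow_add, div_pow _ _ h, hA x hx]
    ring
  have hDper : ∀ n, ‖D (n + h)‖ = ‖D n‖ := by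
    intro n
    have : D (n + h) = (r ^ h / A) * D n := by
      simp only [hD]
      rw [show n + h + 1 = n + 1 + h by ring, hper, hper, Nat.cast_add (n + 1) h,
        ZMod.natCast_self, add_zero]
      ring
    rw [this, norm_mul, norm_div, hAn, norm_pow, Complex.norm_of_nonneg hr.le,
      div_self (pow_ne_zero _ hr.ne'), one_mul]
  have hDj : ∀ j : ℕ, ‖D (n + j * h)‖ = ‖D n‖ := by
    intro j
    induction j with
    | zero => simp
    | succ j ih => rw [← ih, ← hDper (n + j * h), add_mul, one_mul, add_assoc]
  have hD0 : D n = 0 := by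
    have h1 : Tendsto (fun j : ℕ => n + j * h) atTop atTop :=
      tendsto_atTop_mono (fun j =>
        (Nat.le_mul_of_pos_right j hacc.pos).trans (Nat.le_add_left _ _)) tendsto_id
    have h2 := ((key 1).comp h1).norm
    rw [norm_zero] at h2
    exact norm_eq_zero.1 (tendsto_nhds_unique (tendsto_const_nhds.congr fun j => (hDj j).symm) h2)
  have hG : ∀ n, ∑ x ∈ S, c x * (r / x) ^ n = r ^ n * expSum S c n := by
    intro n
    rw [expSum, Finset.mul_sum]
    exact Finset.sum_congr rfl fun x _ => by rw [div_eq_mul_inv, mul_pow]; ring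
  simp only [hD] at hD0
  rw [hG, hG, pow_succ (r : ℂ) n, pow_one, sub_eq_zero] at hD0
  refine mul_left_cancel₀ (pow_ne_zero n hrc) (hD0.trans ?_)
  rw [oppositeInitial]
  field_simp

end

/-! ### Exponential sums satisfying the recurrence -/

/-- The coefficient `cₓ x⁻ᵉ / ∑ c_y y⁻ᵉ` of the geometric series `1 / (1 - x s)` in the opposite
series `a^[e]`. -/
def leadingRatio (S : Finset ℂ) (c : ℂ → ℂ) {h : ℕ} (e : ZMod h) (x : ℂ) : ℂ :=
  c x * x⁻¹ ^ e.val / expSum S c e.val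

section

variable {h : ℕ} {S : Finset ℂ} {c : ℂ → ℂ} {a : ZMod h → ℂ} {A : ℂ}

theorem expSum_add_mul (hA : ∀ x ∈ S, x ^ h = A) (n k : ℕ) :
    expSum S c (n + h * k) = A⁻¹ ^ k * expSum S c n := by
  rw [expSum, expSum, Finset.mul_sum]
  refine Finset.sum_congr rfl fun x hx => ?_
  rw [pow_add, pow_mul, inv_pow x h, hA x hx]
  ring

/-- By the recurrence a zero propagates to all later indices. Fourier inversion over `h` consecutive
values, computed in `h2`, would then give `c x = 0`. -/
theorem expSum_ne_zero [NeZero h] (hA : ∀ x ∈ S, x ^ h = A) (hA0 : A ≠ 0) (hne : S.Nonempty)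
    (hc : ∀ x ∈ S, c x ≠ 0) (ha : ∀ e, a e ≠ 0)
    (hG : ∀ n : ℕ, expSum S c n = a ((n + 1 : ℕ) : ZMod h) * expSum S c (n + 1)) (n : ℕ) :
    expSum S c n ≠ 0 := by
  have hx0 : ∀ x ∈ S, x ≠ 0 := fun x hx h0 => hA0 (by
    rw [← hA x hx, h0, zero_pow (NeZero.ne h)])
  intro hn
  have h1 : ∀ k, expSum S c (n + k) = 0 := by
    intro k
    induction k with
    | zero => exact hn
    | succ k ih =>
      have := hG (n + k)
      rw [ih] at this
      exact (mul_eq_zero.1 this.symm).resolve_left (ha _)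
  obtain ⟨x, hx⟩ := hne
  have h2 : ∑ k ∈ Finset.range h, expSum S c (n + k) * x ^ k = c x * x⁻¹ ^ n * h := by
    simp only [expSum, Finset.sum_mul]
    rw [Finset.sum_comm]
    have h3 : ∀ y ∈ S, ∑ k ∈ Finset.range h, c y * y⁻¹ ^ (n + k) * x ^ k =
        if y = x then c y * y⁻¹ ^ n * h else 0 := by
      intro y hy
      have h4 := sum_range_div_pow (hx0 y hy) ((hA y hy).trans (hA x hx).symm)
      rw [← mul_zero (c y * y⁻¹ ^ n), ← mul_ite, ← h4, Finset.mul_sum]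
      refine Finset.sum_congr rfl fun k _ => ?_
      rw [div_eq_mul_inv, mul_pow, pow_add]
      ring
    rw [Finset.sum_congr rfl h3, Finset.sum_ite_eq' S x, if_pos hx]
  simp only [h1, zero_mul, Finset.sum_const_zero] at h2
  have h5 : (h : ℂ) ≠ 0 := Nat.cast_ne_zero.2 (NeZero.ne h)
  have h6 := pow_ne_zero n (inv_ne_zero (hx0 x hx))
  exact mul_ne_zero (mul_ne_zero (hc x hx) h6) h5 h2.symm

theorem prod_Icc_eq_expSum_div [NeZero h] (h0 : ∀ n, expSum S c n ≠ 0)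
    (hG : ∀ n : ℕ, expSum S c n = a ((n + 1 : ℕ) : ZMod h) * expSum S c (n + 1)) (N k : ℕ) :
    ∏ i ∈ Finset.Icc 1 k, a (((N + k : ℕ) : ZMod h) - (i : ZMod h) + 1) =
      expSum S c N / expSum S c (N + k) := by
  induction k generalizing N with
  | zero => simp [h0]
  | succ k ih =>
    have h1 := ih (N + 1)
    rw [show N + 1 + k = N + (k + 1) by ring] at h1
    rw [Finset.prod_Icc_succ_top (by omega), h1, hG N]
    have h2 : ((N + (k + 1) : ℕ) : ZMod h) - ((k + 1 : ℕ) : ZMod h) + 1 =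
        ((N + 1 : ℕ) : ZMod h) := by push_cast; ring
    rw [h2]
    ring

/-- The product telescopes to `E(e - k) / E(e)`. For `k` the index of a coefficient this is the
partial fraction expansion of `a^[e]`. -/
theorem prod_Icc_eq_sum_leadingRatio [NeZero h] (hA : ∀ x ∈ S, x ^ h = A) (hA0 : A ≠ 0)
    (h0 : ∀ n, expSum S c n ≠ 0)
    (hG : ∀ n : ℕ, expSum S c n = a ((n + 1 : ℕ) : ZMod h) * expSum S c (n + 1))
    (e : ZMod h) (k : ℕ) :
    ∏ i ∈ Finset.Icc 1 k, a (e - (i : ZMod h) + 1) = ∑ x ∈ S, leadingRatio S c e x * x ^ k := by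
  have hk : k ≤ e.val + h * k :=
    (Nat.le_mul_of_pos_left k (NeZero.pos h)).trans (Nat.le_add_left _ _)
  -- Adding `h * k` stays in the class of `e` and makes the subtraction of `k` legitimate in `ℕ`;
  -- the resulting powers of `A` cancel.
  have h1 := prod_Icc_eq_expSum_div h0 hG (e.val + h * k - k) k
  rw [Nat.sub_add_cancel hk] at h1
  have h2 : ((e.val + h * k : ℕ) : ZMod h) = e := by simp
  rw [h2, expSum_add_mul hA] at h1
  rw [h1, expSum, Finset.sum_div]
  refine Finset.sum_congr rfl fun x hx => ?_
  have hx0 : x ≠ 0 := fun hx0 => hA0 (by rw [← hA x hx, hx0, zero_pow (NeZero.ne h)])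
  have h3 : x⁻¹ ^ (e.val + h * k - k) = x⁻¹ ^ e.val * A⁻¹ ^ k * x ^ k := by
    rw [← hA x hx, ← inv_pow, ← pow_mul, ← pow_add]
    rw [inv_pow, inv_pow, eq_comm, inv_mul_eq_iff_eq_mul₀ (pow_ne_zero _ hx0),
      eq_mul_inv_iff_mul_eq₀ (pow_ne_zero _ hx0), ← pow_add, Nat.add_sub_cancel' hk]
  rw [h3, leadingRatio]
  have h4 := h0 e.val
  field_simp

/-- The coefficients of `A^[e]` are the first `h` coefficients `∑ λ(e,y) yᵏ` of `a^[e]`;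
orthogonality of the `h`-th roots of `A` leaves only the term `y = x`. -/
theorem eval_numeratorPoly [NeZero h] (hA : ∀ x ∈ S, x ^ h = A) (hA0 : A ≠ 0)
    (h0 : ∀ n, expSum S c n ≠ 0)
    (hG : ∀ n : ℕ, expSum S c n = a ((n + 1 : ℕ) : ZMod h) * expSum S c (n + 1))
    (e : ZMod h) {x : ℂ} (hx : x ^ h = A) :
    (numeratorPoly a e).eval x⁻¹ = if x ∈ S then leadingRatio S c e x * h else 0 := by
  have hx0 : x ≠ 0 := fun hx0 => hA0 (by rw [← hx, hx0, zero_pow (NeZero.ne h)])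
  rw [numeratorPoly, eval_finsetSum]
  simp only [eval_mul, eval_C, eval_pow, eval_X, prod_Icc_eq_sum_leadingRatio hA hA0 h0 hG,
    Finset.sum_mul]
  rw [Finset.sum_comm]
  have h3 : ∀ y ∈ S, ∑ k ∈ Finset.range h, leadingRatio S c e y * y ^ k * x⁻¹ ^ k =
      if x = y then leadingRatio S c e y * h else 0 := by
    intro y hy
    have h4 := sum_range_div_pow hx0 (hx.trans (hA y hy).symm)
    rw [← mul_zero (leadingRatio S c e y), ← mul_ite, ← h4, Finset.mul_sum]
    refine Finset.sum_congr rfl fun k _ => ?_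
    rw [div_eq_mul_inv, mul_pow]
    ring
  rw [Finset.sum_congr rfl h3, Finset.sum_ite_eq]

/-- The explicit left inverse of the matrix `λ(e,x)`: the weight cancels `E(e)` and leaves a sum of
powers of `x / y`. Both rank computations rest on it. -/
theorem sum_mul_leadingRatio [NeZero h] (hA : ∀ x ∈ S, x ^ h = A) (hA0 : A ≠ 0)
    (hc : ∀ x ∈ S, c x ≠ 0) (h0 : ∀ n, expSum S c n ≠ 0) {x y : ℂ} (hx : x ∈ S) (hy : y ∈ S) :
    ∑ e : ZMod h, expSum S c e.val * x ^ e.val / (h * c x) * leadingRatio S c e y =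
      if x = y then 1 else 0 := by
  have hx0 : ∀ x ∈ S, x ≠ 0 := fun x hx h0 => hA0 (by
    rw [← hA x hx, h0, zero_pow (NeZero.ne h)])
  have hh : (h : ℂ) ≠ 0 := Nat.cast_ne_zero.2 (NeZero.ne h)
  have hcx := hc x hx
  have h4 := sum_range_div_pow (hx0 y hy) ((hA y hy).trans (hA x hx).symm)
  have h5 : ∀ e : ZMod h, expSum S c e.val * x ^ e.val / (h * c x) * leadingRatio S c e y =
      c y / (h * c x) * (x / y) ^ e.val := by
    intro e
    have := h0 e.val
    rw [leadingRatio, div_pow, inv_pow]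
    field_simp
  simp only [h5]
  rw [sum_zmod_val fun k => c y / (h * c x) * (x / y) ^ k, ← Finset.mul_sum, h4]
  split_ifs with h1 h2 h2
  · subst h1
    field_simp
  · exact absurd h1.symm h2
  · exact absurd h2.symm h1
  · rw [mul_zero]

/-! ### Rank of the span of the opposite series -/

/-- The geometric series `1 / (1 - x s)`. -/
def geomSeries (x : ℂ) : PowerSeries ℂ := PowerSeries.mk fun k => x ^ k

theorem linearIndependent_geomSeries [NeZero h] (hA : ∀ x ∈ S, x ^ h = A) (hA0 : A ≠ 0) :
    LinearIndependent ℂ fun x : S => geomSeries x := by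
  rw [Fintype.linearIndependent_iff]
  intro g hg x
  have hx0 : (x : ℂ) ≠ 0 := fun hx0 => hA0 (by
    rw [← hA x x.2, hx0, zero_pow (NeZero.ne h)])
  have h1 : ∀ k : ℕ, ∑ y : S, g y * (y : ℂ) ^ k = 0 := by
    intro k
    have := congrArg (PowerSeries.coeff k) hg
    simpa [geomSeries] using this
  have h2 : ∑ k ∈ Finset.range h, (∑ y : S, g y * (y : ℂ) ^ k) * (x : ℂ)⁻¹ ^ k = g x * h := by
    simp only [Finset.sum_mul]
    rw [Finset.sum_comm]
    have h3 : ∀ y : S, ∑ k ∈ Finset.range h, g y * (y : ℂ) ^ k * (x : ℂ)⁻¹ ^ k =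
        if x = y then g y * h else 0 := by
      intro y
      have h4 := sum_range_div_pow hx0 ((hA x x.2).trans (hA y y.2).symm)
      simp only [Subtype.ext_iff]
      rw [← mul_zero (g y), ← mul_ite, ← h4, Finset.mul_sum]
      refine Finset.sum_congr rfl fun k _ => ?_
      rw [div_eq_mul_inv, mul_pow]
      ring
    simp only [h3]
    simp
  simp only [h1, zero_mul, Finset.sum_const_zero] at h2
  exact (mul_eq_zero.1 h2.symm).resolve_right (Nat.cast_ne_zero.2 (NeZero.ne h))

theorem span_range_eq_span_geomSeries [NeZero h] (hA : ∀ x ∈ S, x ^ h = A) (hA0 : A ≠ 0)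
    (hc : ∀ x ∈ S, c x ≠ 0) (h0 : ∀ n, expSum S c n ≠ 0) {b : ZMod h → PowerSeries ℂ}
    (hb : ∀ e k, PowerSeries.coeff k (b e) = ∑ x ∈ S, leadingRatio S c e x * x ^ k) :
    Submodule.span ℂ (Set.range b) =
      Submodule.span ℂ (Set.range fun x : S => geomSeries x) := by
  have hb' : ∀ e, b e = ∑ x ∈ S, leadingRatio S c e x • geomSeries x := by
    intro e
    ext k
    simp [hb, geomSeries]
  refine le_antisymm (Submodule.span_le.2 ?_) (Submodule.span_le.2 ?_)
  · rintro _ ⟨e, rfl⟩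
    rw [hb']
    exact Submodule.sum_mem _ fun x hx =>
      Submodule.smul_mem _ _ (Submodule.subset_span ⟨⟨x, hx⟩, rfl⟩)
  · rintro _ ⟨x, rfl⟩
    -- The left inverse expresses each geometric series through the opposite series.
    have h1 : geomSeries x =
        ∑ e : ZMod h, (expSum S c e.val * (x : ℂ) ^ e.val / (h * c x)) • b e := by
      simp only [hb', Finset.smul_sum, smul_smul]
      rw [Finset.sum_comm]
      simp only [← Finset.sum_smul]
      rw [Finset.sum_congr rfl fun y hy => by rw [sum_mul_leadingRatio hA hA0 hc h0 x.2 hy]]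
      simp
    change geomSeries x ∈ _
    rw [h1]
    exact Submodule.sum_mem _ fun e _ => Submodule.smul_mem _ _ (Submodule.subset_span ⟨e, rfl⟩)

theorem rank_leadingRatio_mul [NeZero h] (hA : ∀ x ∈ S, x ^ h = A) (hA0 : A ≠ 0)
    (hc : ∀ x ∈ S, c x ≠ 0) (h0 : ∀ n, expSum S c n ≠ 0) {ι : Type*} [Fintype ι] {v : ι → ℂ}
    (hv : Function.Injective v) (hvS : ∀ i, v i ∈ S) :
    (Matrix.of fun (e : ZMod h) (i : ι) => leadingRatio S c e (v i) * h).rank =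
      Fintype.card ι := by
  classical
  have hh : (h : ℂ) ≠ 0 := Nat.cast_ne_zero.2 (NeZero.ne h)
  refine le_antisymm (Matrix.rank_le_card_width _) ?_
  set B : Matrix ι (ZMod h) ℂ := Matrix.of fun i e =>
    expSum S c e.val * v i ^ e.val / (h * c (v i)) * (h : ℂ)⁻¹ with hB
  have h1 : B * (Matrix.of fun (e : ZMod h) (i : ι) => leadingRatio S c e (v i) * h) = 1 := by
    ext i j
    rw [Matrix.mul_apply, Matrix.one_apply, ← if_congr hv.eq_iff rfl rfl,
      ← sum_mul_leadingRatio hA hA0 hc h0 (hvS i) (hvS j)]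
    refine Finset.sum_congr rfl fun e _ => ?_
    simp only [hB, Matrix.of_apply]
    field_simp
  rw [← Matrix.rank_one (R := ℂ) (n := ι), ← h1]
  exact Matrix.rank_mul_le_right _ _

/-! ### The opposite denominator polynomial -/

theorem reflect_one_sub_C_mul_X_pow (x : ℂ) (k : ℕ) :
    (1 - C x * X ^ k : ℂ[X]).reflect k = X ^ k - C x := by
  rw [reflect_sub, reflect_one, reflect_C_mul_X_pow, revAt_le le_rfl, Nat.sub_self, pow_zero,
    mul_one]

theorem reflect_prod_one_sub (S : Finset ℂ) :
    (∏ x ∈ S, (1 - C x * X) : ℂ[X]).reflect S.card = ∏ x ∈ S, (X - C x) := by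
  classical
  induction S using Finset.induction_on with
  | empty => simp
  | insert x S hx ih =>
    have h1 : (1 - C x * X : ℂ[X]).natDegree ≤ 1 := by
      compute_degree
    have h2 : (∏ x ∈ S, (1 - C x * X) : ℂ[X]).natDegree ≤ S.card := by
      refine (natDegree_prod_le _ _).trans ((Finset.sum_le_card_nsmul _ _ 1 fun y _ => ?_).trans
        (by simp))
      compute_degree
    rw [Finset.prod_insert hx, Finset.prod_insert hx, Finset.card_insert_of_notMem hx, add_comm,
      reflect_mul _ _ h1 h2, ih]
    congr 1
    simp

theorem exists_finset_roots [NeZero h] (A : ℂ) (hA0 : A ≠ 0) :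
    ∃ R : Finset ℂ, (∀ x, x ∈ R ↔ x ^ h = A) ∧
      (1 - C A * X ^ h : ℂ[X]) = ∏ x ∈ R, (1 - C x * X) := by
  classical
  obtain ⟨α, hα⟩ := IsAlgClosed.exists_pow_nat_eq A (NeZero.pos h)
  have hα0 : α ≠ 0 := fun h0 => hA0 (by rw [← hα, h0, zero_pow (NeZero.ne h)])
  have hζ := Complex.isPrimitiveRoot_exp h (NeZero.ne h)
  set ζ := Complex.exp (2 * Real.pi * Complex.I / h)
  have hinj : Set.InjOn (fun i => ζ ^ i * α) (Finset.range h) := fun i hi j hj hij =>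
    hζ.pow_inj (Finset.mem_range.1 hi) (Finset.mem_range.1 hj) (mul_right_cancel₀ hα0 hij)
  set R := (Finset.range h).image fun i => ζ ^ i * α with hR
  have h2 : (X ^ h - C A : ℂ[X]) = ∏ x ∈ R, (X - C x) := by
    rw [hR, Finset.prod_image hinj, X_pow_sub_C_eq_prod hζ (NeZero.pos h) hα]
  have hcard : R.card = h := by
    rw [hR, Finset.card_image_of_injOn hinj, Finset.card_range]
  refine ⟨R, fun x => ?_, ?_⟩
  · have h3 := congrArg (eval x) h2
    rw [eval_prod] at h3
    simp only [eval_sub, eval_pow, eval_X, eval_C] at h3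
    rw [← sub_eq_zero (a := x ^ h), h3, Finset.prod_eq_zero_iff]
    simp [sub_eq_zero]
  -- Reflection in degree `h` exchanges `1 - A s^h` with `s^h - A`, and each `1 - x s` with `s - x`.
  · rw [← reflect_reflect (N := h) (p := ∏ x ∈ R, (1 - C x * X)), ← hcard, reflect_prod_one_sub,
      hcard, ← h2, ← reflect_one_sub_C_mul_X_pow, reflect_reflect]

theorem isCoprime_one_sub_C_mul_X {x y : ℂ} (hxy : x ≠ y) :
    IsCoprime (1 - C x * X : ℂ[X]) (1 - C y * X) := by
  have h1 : y - x ≠ 0 := sub_ne_zero.2 hxy.symm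
  refine ⟨C (y / (y - x)), -C (x / (y - x)), ?_⟩
  have h2 : C (y / (y - x)) - C (x / (y - x)) = (1 : ℂ[X]) := by
    rw [← C_sub, ← sub_div, div_self h1, C_1]
  have h3 : C (y / (y - x)) * C x = (C (x / (y - x)) * C y : ℂ[X]) := by
    rw [← C_mul, ← C_mul]
    congr 1
    ring
  linear_combination h2 - X * h3

theorem one_sub_C_mul_X_dvd_iff {x : ℂ} (hx : x ≠ 0) {p : ℂ[X]} :
    (1 - C x * X : ℂ[X]) ∣ p ↔ p.eval x⁻¹ = 0 := by
  have h1 : (1 - C x * X : ℂ[X]) = C (-x) * (X - C x⁻¹) := by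
    rw [mul_sub, ← C_mul, neg_mul, mul_inv_cancel₀ hx, C_neg, C_neg, C_1]
    ring
  have h2 : IsUnit (C (-x) : ℂ[X]) := isUnit_C.2 (neg_ne_zero.2 hx).isUnit
  rw [h1, h2.mul_left_dvd, dvd_iff_isRoot, IsRoot]

/-- Since `1 - A s^h` is a product of pairwise coprime linear factors, the gcd collects those at
whose root the numerator vanishes, namely `x ∉ S`. The product has constant term `1`, which fixes
the unit. -/
theorem commonFactor_eq_prod {R : Finset ℂ} (hR0 : ∀ x ∈ R, x ≠ 0) (hSR : S ⊆ R)
    (hprod : (1 - C (cyclicProduct a) * X ^ h : ℂ[X]) = ∏ x ∈ R, (1 - C x * X))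
    (heval : ∀ x ∈ R, (numeratorPoly a 0).eval x⁻¹ = 0 ↔ x ∉ S) :
    commonFactor a = ∏ x ∈ R \ S, (1 - C x * X) := by
  classical
  set D : ℂ[X] := ∏ x ∈ R \ S, (1 - C x * X) with hD
  rw [commonFactor]
  set g := EuclideanDomain.gcd (numeratorPoly a 0) (1 - C (cyclicProduct a) * X ^ h) with hg
  have hsplit : (1 - C (cyclicProduct a) * X ^ h : ℂ[X]) = D * ∏ x ∈ S, (1 - C x * X) := by
    rw [hprod, Finset.prod_sdiff hSR]
  have hpair : Set.Pairwise (↑(R \ S) : Set ℂ)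
      (Function.onFun IsCoprime fun x => (1 - C x * X : ℂ[X])) :=
    fun x _ y _ hxy => isCoprime_one_sub_C_mul_X hxy
  have h1 : D ∣ g := by
    refine EuclideanDomain.dvd_gcd (Finset.prod_dvd_of_coprime hpair fun x hx => ?_)
      ⟨_, hsplit⟩
    rw [Finset.mem_sdiff] at hx
    exact (one_sub_C_mul_X_dvd_iff (hR0 x hx.1)).2 ((heval x hx.1).2 hx.2)
  have h2 : g ∣ D := by
    have hdvd : g ∣ D * ∏ x ∈ S, (1 - C x * X) :=
      hsplit ▸ EuclideanDomain.gcd_dvd_right _ _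
    refine (IsCoprime.prod_right fun x hx => ?_).dvd_of_dvd_mul_right hdvd
    have hx0 := hR0 x (hSR hx)
    have hirr : Irreducible (1 - C x * X : ℂ[X]) := by
      refine irreducible_of_degree_eq_one ?_
      rw [show (1 - C x * X : ℂ[X]) = C (-x) * X + C 1 by rw [C_neg, C_1]; ring]
      exact degree_linear (neg_ne_zero.2 hx0)
    refine ((hirr.coprime_iff_not_dvd).2 fun hd => ?_).symm
    exact (heval x (hSR hx)).1 ((one_sub_C_mul_X_dvd_iff hx0).1
      (hd.trans (EuclideanDomain.gcd_dvd_left _ _))) hx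
  obtain ⟨u, hu⟩ := associated_of_dvd_dvd h1 h2
  obtain ⟨k, hk, hku⟩ := Polynomial.isUnit_iff.1 u.isUnit
  have hD0 : D.coeff 0 = 1 := by
    rw [hD, coeff_zero_eq_eval_zero, eval_prod]
    simp
  rw [← hku] at hu
  rw [← hu, mul_coeff_zero, hD0, coeff_C_zero, one_mul, mul_left_comm, ← C_mul,
    inv_mul_cancel₀ hk.ne_zero, C_1, mul_one]

theorem one_sub_div_commonFactor {R : Finset ℂ} (hR0 : ∀ x ∈ R, x ≠ 0) (hSR : S ⊆ R)
    (hprod : (1 - C (cyclicProduct a) * X ^ h : ℂ[X]) = ∏ x ∈ R, (1 - C x * X))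
    (heval : ∀ x ∈ R, (numeratorPoly a 0).eval x⁻¹ = 0 ↔ x ∉ S) :
    (1 - C (cyclicProduct a) * X ^ h) / commonFactor a = ∏ x ∈ S, (1 - C x * X) := by
  classical
  rw [commonFactor_eq_prod hR0 hSR hprod heval, hprod, ← Finset.prod_sdiff hSR]
  refine mul_div_cancel_left₀ _ (Finset.prod_ne_zero_iff.2 fun x _ h0 => ?_)
  have := congrArg (eval 0) h0
  simp at this

theorem natDegree_prod_one_sub (hS0 : ∀ x ∈ S, x ≠ 0) :
    (∏ x ∈ S, (1 - C x * X) : ℂ[X]).natDegree = S.card := by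
  rw [natDegree_prod _ _ fun x _ h0 => by simpa using congrArg (eval 0) h0,
    Finset.sum_congr rfl fun x hx => ?_, Finset.card_eq_sum_ones]
  rw [show (1 - C x * X : ℂ[X]) = C (-x) * X + C 1 by rw [C_neg, C_1]; ring]
  exact natDegree_linear (neg_ne_zero.2 (hS0 x hx))

end

/-! ### The polar part and the top denominator polynomial -/

theorem meromorphicOrderAt_eval {Q : ℂ[X]} (hQ : Q ≠ 0) (x : ℂ) :
    meromorphicOrderAt (fun z => Q.eval z) x = (Q.rootMultiplicity x : ℤ) := by
  obtain ⟨R, hR, hnd⟩ := exists_eq_pow_rootMultiplicity_mul_and_not_dvd Q hQ x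
  have hmer : MeromorphicAt (fun z => Q.eval z) x :=
    (AnalyticOnNhd.eval_polynomial (𝕜 := ℂ) Q x (Set.mem_univ x)).meromorphicAt
  refine (meromorphicOrderAt_eq_int_iff hmer).2
    ⟨fun z => R.eval z, AnalyticOnNhd.eval_polynomial R x (Set.mem_univ x),
      fun h => hnd (dvd_iff_isRoot.2 h), Eventually.of_forall fun z => ?_⟩
  conv_lhs => rw [hR]
  simp

theorem meromorphicOrderAt_eval_mul {Q : ℂ[X]} (hQ : Q ≠ 0) {f : ℂ → ℂ} {x : ℂ}
    (hf : MeromorphicAt f x) : meromorphicOrderAt (fun z => Q.eval z * f z) x =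
      (Q.rootMultiplicity x : ℤ) + meromorphicOrderAt f x := by
  rw [← meromorphicOrderAt_eval hQ]
  exact meromorphicOrderAt_mul
    (AnalyticOnNhd.eval_polynomial (𝕜 := ℂ) Q x (Set.mem_univ x)).meromorphicAt hf

theorem cancelsPoles_iff {r : ℝ} {f : ℂ → ℂ} (hf : ∀ x : ℂ, ‖x‖ = r → MeromorphicAt f x) {Q : ℂ[X]}
    (hQ : Q ≠ 0) : CancelsPoles r f Q ↔
      ∀ x : ℂ, ‖x‖ = r → 0 ≤ ((Q.rootMultiplicity x : ℤ) : WithTop ℤ) + meromorphicOrderAt f x := by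
  constructor
  · rintro ⟨g, hg, heq⟩ x hx
    rw [← meromorphicOrderAt_eval_mul hQ (hf x hx),
      ← meromorphicOrderAt_congr (heq x (by simpa using hx))]
    exact (hg x (by simpa using hx)).meromorphicOrderAt_nonneg
  · intro h
    have hm : MeromorphicOn (fun z => Q.eval z * f z) (Metric.sphere 0 r) := fun x hx =>
      (AnalyticOnNhd.eval_polynomial (𝕜 := ℂ) Q x (Set.mem_univ x)).meromorphicAt.mul
        (hf x (by simpa using hx))
    refine ⟨toMeromorphicNFOn (fun z => Q.eval z * f z) (Metric.sphere 0 r), fun x hx => ?_,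
      fun x hx => hm.toMeromorphicNFOn_eq_self_on_nhdsNE hx⟩
    have hx' : ‖x‖ = r := by simpa using hx
    rw [← (meromorphicNFOn_toMeromorphicNFOn _ _ hx).meromorphicOrderAt_nonneg_iff_analyticAt,
      meromorphicOrderAt_toMeromorphicNFOn hm hx, meromorphicOrderAt_eval_mul hQ (hf x hx')]
    exact h x hx'

/-- The order of the pole of `f` at `x`, or `0` if there is none. -/
def poleOrder (f : ℂ → ℂ) (x : ℂ) : ℕ := (-(meromorphicOrderAt f x).untop₀).toNat

theorem nonneg_add_iff_poleOrder_le (f : ℂ → ℂ) (x : ℂ) (k : ℕ) :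
    0 ≤ ((k : ℤ) : WithTop ℤ) + meromorphicOrderAt f x ↔ poleOrder f x ≤ k := by
  rw [poleOrder]
  generalize meromorphicOrderAt f x = o
  induction o with
  | top => simp
  | coe o =>
    rw [WithTop.untop₀_coe, Int.toNat_le]
    have : 0 ≤ ((k : ℤ) : WithTop ℤ) + (o : WithTop ℤ) ↔ 0 ≤ (k : ℤ) + o := by
      exact_mod_cast Iff.rfl
    rw [this]
    omega

theorem poleOrder_pos_iff (f : ℂ → ℂ) (x : ℂ) :
    0 < poleOrder f x ↔ meromorphicOrderAt f x < 0 := by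
  have := nonneg_add_iff_poleOrder_le f x 0
  simp only [Nat.cast_zero, WithTop.coe_zero, zero_add] at this
  rw [← not_le, ← this, not_le]

theorem poleOrder_eq_succ_iff (f : ℂ → ℂ) (x : ℂ) (m : ℕ) : poleOrder f x = m + 1 ↔
    meromorphicOrderAt f x = ((-(m + 1 : ℕ) : ℤ) : WithTop ℤ) := by
  rw [poleOrder]
  generalize meromorphicOrderAt f x = o
  induction o with
  | top => exact iff_of_false (by simp) WithTop.top_ne_coe
  | coe o =>
    rw [WithTop.untop₀_coe, WithTop.coe_inj]
    omega

theorem rootMultiplicity_prod_X_sub_C_pow (E : Finset ℂ) (d : ℂ → ℕ) (y : ℂ) :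
    (∏ x ∈ E, (X - C x) ^ d x).rootMultiplicity y = if y ∈ E then d y else 0 := by
  classical
  have hne : ∏ x ∈ E, (X - C x) ^ d x ≠ 0 :=
    Finset.prod_ne_zero_iff.2 fun x _ => pow_ne_zero _ (X_sub_C_ne_zero x)
  rw [← count_roots, roots_prod _ _ hne, Multiset.count_bind]
  simp only [roots_pow, roots_X_sub_C, Multiset.count_nsmul, Multiset.count_singleton]
  change ∑ x ∈ E, d x * (if y = x then 1 else 0) = _
  simp

section

variable {r : ℝ} {f : ℂ → ℂ} {E : Finset ℂ}

/-- A cancelling polynomial vanishes at each pole to at least the order of the pole, so the product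
divides it. Minimal degree and monicity then give equality. -/
theorem isPolarPart_iff (hf : ∀ x : ℂ, ‖x‖ = r → MeromorphicAt f x)
    (hE : ∀ x, x ∈ E ↔ ‖x‖ = r ∧ meromorphicOrderAt f x < 0) (Q : ℂ[X]) :
    IsPolarPart r f Q ↔ Q = ∏ x ∈ E, (X - C x) ^ poleOrder f x := by
  set D := ∏ x ∈ E, (X - C x) ^ poleOrder f x with hD
  have hDm : D.Monic := monic_prod_of_monic _ _ fun x _ => (monic_X_sub_C x).pow _
  have hDc : CancelsPoles r f D := by
    refine (cancelsPoles_iff hf hDm.ne_zero).2 fun x hx => ?_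
    rw [nonneg_add_iff_poleOrder_le, hD, rootMultiplicity_prod_X_sub_C_pow]
    split_ifs with h
    · exact le_rfl
    · by_contra! h0
      exact h ((hE x).2 ⟨hx, (poleOrder_pos_iff f x).1 h0⟩)
  have hdvd : ∀ R : ℂ[X], R.Monic → CancelsPoles r f R → D ∣ R := by
    intro R hR hRc
    refine Finset.prod_dvd_of_coprime (fun x _ y _ hxy => ?_) fun x hx => ?_
    · exact (isCoprime_X_sub_C_of_isUnit_sub (sub_ne_zero.2 hxy).isUnit).pow
    · refine (le_rootMultiplicity_iff hR.ne_zero).1 ?_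
      rw [← nonneg_add_iff_poleOrder_le]
      exact (cancelsPoles_iff hf hR.ne_zero).1 hRc x ((hE x).1 hx).1
  constructor
  · rintro ⟨hQ, hQc, hmin⟩
    exact eq_of_monic_of_dvd_of_natDegree_le hDm hQ (hdvd Q hQ hQc) (hmin D hDm hDc)
  · rintro rfl
    exact ⟨hDm, hDc, fun R hR hRc => natDegree_le_of_dvd (hdvd R hR hRc) hR.ne_zero⟩

theorem topDenominator_eq_prod {P : PowerSeries ℂ}
    (hf : IsMeromorphicExtension r P (meromorphicExtension r P)) {m : ℕ} {S : Finset ℂ}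
    (hne : S.Nonempty) (hge : ∀ x : ℂ, ‖x‖ = r →
      ((-(m + 1 : ℕ) : ℤ) : WithTop ℤ) ≤ meromorphicOrderAt (meromorphicExtension r P) x)
    (hS : ∀ x, x ∈ S ↔ ‖x‖ = r ∧ meromorphicOrderAt (meromorphicExtension r P) x =
      ((-(m + 1 : ℕ) : ℤ) : WithTop ℤ)) :
    topDenominator r P = ∏ x ∈ S, (X - C x) := by
  classical
  set g := meromorphicExtension r P with hg
  have hm : ∀ x : ℂ, ‖x‖ = r → MeromorphicAt g x := fun x hx => hf.meromorphicAt hx.le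
  set E := hf.finite_poles.toFinset with hEdef
  have hE : ∀ x, x ∈ E ↔ ‖x‖ = r ∧ meromorphicOrderAt g x < 0 := by simp [hEdef]
  have hpol : polarPart r P = ∏ x ∈ E, (X - C x) ^ poleOrder g x := by
    have hex : ∃ Q, IsPolarPart r (meromorphicExtension r P) Q :=
      ⟨_, (isPolarPart_iff hm hE _).2 rfl⟩
    rw [polarPart, dif_pos hex]
    exact (isPolarPart_iff hm hE _).1 hex.choose_spec
  have hmult : ∀ x, (polarPart r P).rootMultiplicity x = if x ∈ E then poleOrder g x else 0 := by
    rw [hpol]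
    exact rootMultiplicity_prod_X_sub_C_pow E _
  have hpol0 : polarPart r P ≠ 0 := by
    rw [hpol]
    exact (monic_prod_of_monic _ _ fun x _ => (monic_X_sub_C x).pow _).ne_zero
  have hroots : ∀ x, x ∈ (polarPart r P).roots.toFinset ↔ x ∈ E := by
    intro x
    rw [Multiset.mem_toFinset, mem_roots hpol0, ← rootMultiplicity_pos hpol0, hmult]
    split_ifs with h
    · simp [h, poleOrder_pos_iff, ((hE x).1 h).2]
    · simp [h]
  have hSE : ∀ x ∈ S, x ∈ E := fun x hx => (hE x).2 ⟨((hS x).1 hx).1, by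
    rw [((hS x).1 hx).2]
    exact_mod_cast (by omega : -((m + 1 : ℕ) : ℤ) < 0)⟩
  have hle : ∀ x ∈ E, poleOrder g x ≤ m + 1 := by
    intro x hx
    rw [← nonneg_add_iff_poleOrder_le]
    have h1 : (((m + 1 : ℕ) : ℤ) : WithTop ℤ) + ((-(m + 1 : ℕ) : ℤ) : WithTop ℤ) = 0 := by
      have : ((m + 1 : ℕ) : ℤ) + (-(m + 1 : ℕ) : ℤ) = 0 := by ring
      exact_mod_cast this
    rw [← h1]
    gcongr
    exact hge x ((hE x).1 hx).1
  have hsup : ((polarPart r P).roots.toFinset.sup fun y => (polarPart r P).rootMultiplicity y) =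
      m + 1 := by
    refine le_antisymm (Finset.sup_le fun x hx => ?_) ?_
    · rw [hmult, if_pos ((hroots x).1 hx)]
      exact hle x ((hroots x).1 hx)
    · obtain ⟨x, hx⟩ := hne
      refine le_trans (le_of_eq ?_) (Finset.le_sup ((hroots x).2 (hSE x hx)))
      rw [hmult, if_pos (hSE x hx), eq_comm, poleOrder_eq_succ_iff]
      exact ((hS x).1 hx).2
  rw [topDenominator, hsup]
  congr 1
  ext x
  rw [Finset.mem_filter, hroots, hmult, hS]
  constructor
  · rintro ⟨hx, h1⟩
    rw [if_pos hx, poleOrder_eq_succ_iff] at h1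
    exact ⟨((hE x).1 hx).1, h1⟩
  · intro hx
    have hxE := hSE x ((hS x).2 hx)
    refine ⟨hxE, ?_⟩
    rw [if_pos hxE, poleOrder_eq_succ_iff]
    exact hx.2

theorem topPoles_eq {m : ℕ} {S : Finset ℂ} (hne : S.Nonempty) (hge : ∀ x : ℂ, ‖x‖ = r →
      ((-(m + 1 : ℕ) : ℤ) : WithTop ℤ) ≤ meromorphicOrderAt f x)
    (hS : ∀ x, x ∈ S ↔ ‖x‖ = r ∧ meromorphicOrderAt f x = ((-(m + 1 : ℕ) : ℤ) : WithTop ℤ)) :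
    topPoles r f = S := by
  ext x
  rw [Finset.mem_coe, hS]
  constructor
  · rintro ⟨hx, -, hmin⟩
    obtain ⟨y, hy⟩ := hne
    refine ⟨hx, le_antisymm ?_ (hge x hx)⟩
    rw [← ((hS y).1 hy).2]
    exact hmin y ((hS y).1 hy).1
  · rintro ⟨hx, ho⟩
    refine ⟨hx, ?_, fun y hy => ho ▸ hge y hy⟩
    rw [ho]
    exact_mod_cast (by omega : -((m + 1 : ℕ) : ℤ) < 0)

theorem rootSet_prod_X_sub_C (S : Finset ℂ) : (∏ x ∈ S, (X - C x) : ℂ[X]).rootSet ℂ = S := by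
  classical
  rw [rootSet, aroots_def, Algebra.algebraMap_self, Polynomial.map_id, roots_prod_X_sub_C]
  ext x
  simp

end

/-! ### The rational operators -/

section

variable {r : ℝ} {P : PowerSeries ℂ} {f : ℂ → ℂ} {h : ℕ}

/-- The average `h⁻¹ ∑ ζ⁻ⁱᵉ f(ζⁱ z)` over the `h`-th roots of unity. -/
def rotationAverage (ζ : ℂ) (f : ℂ → ℂ) {h : ℕ} (e : ZMod h) (z : ℂ) : ℂ :=
  (h : ℂ)⁻¹ * ∑ i ∈ Finset.range h, (ζ ^ i)⁻¹ ^ e.val * f (ζ ^ i * z)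

theorem norm_pow_mul_of_isPrimitiveRoot {ζ : ℂ} (hζ : IsPrimitiveRoot ζ h) (hh : h ≠ 0) (i : ℕ)
    (z : ℂ) : ‖ζ ^ i * z‖ = ‖z‖ := by
  rw [norm_mul, norm_pow, hζ.norm'_eq_one hh, one_pow, one_mul]

/-- Averaging multiplies the `n`-th coefficient by `h⁻¹ ∑ᵢ ζ^(i(n-e))`, the indicator of `n ≡ e mod
h`. -/
theorem IsMeromorphicExtension.rotationAverage [NeZero h] (hf : IsMeromorphicExtension r P f)
    {ζ : ℂ} (hζ : IsPrimitiveRoot ζ h) (e : ZMod h) :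
    IsMeromorphicExtension r (rationalOp (residueSet h e) P) (rotationAverage ζ f e) := by
  have hh : h ≠ 0 := NeZero.ne h
  have hhc : (h : ℂ) ≠ 0 := Nat.cast_ne_zero.2 hh
  have hζ0 : ζ ≠ 0 := hζ.ne_zero hh
  refine ⟨fun z hz => ?_, ?_⟩
  · have h1 : HasSum (fun n : ℕ => (h : ℂ)⁻¹ * ∑ i ∈ Finset.range h, (ζ ^ i)⁻¹ ^ e.val *
        (PowerSeries.coeff n P * (ζ ^ i * z) ^ n)) (_root_.rotationAverage ζ f e z) := by
      refine (hasSum_sum fun i _ => (hf.1 (ζ ^ i * z) ?_).mul_left _).mul_left _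
      rw [mem_ball_zero_iff, norm_pow_mul_of_isPrimitiveRoot hζ hh]
      simpa using hz
    refine h1.congr_fun fun n => ?_
    have h2 : (ζ ^ e.val) ^ h = (ζ ^ n) ^ h := by
      rw [← pow_mul, ← pow_mul, mul_comm, mul_comm n, pow_mul, pow_mul, hζ.pow_eq_one, one_pow,
        one_pow]
    have h3 := sum_range_div_pow (pow_ne_zero e.val hζ0) h2
    have h4 : ζ ^ e.val = ζ ^ n ↔ n ∈ residueSet h e := by
      have h5 : ζ ^ n = ζ ^ (n % h) := by
        conv_lhs => rw [← Nat.mod_add_div n h, pow_add, pow_mul, hζ.pow_eq_one, one_pow, mul_one]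
      have h6 : n ∈ residueSet h e ↔ n % h = e.val := by
        constructor
        · intro hn
          rw [← ZMod.val_natCast, show (n : ZMod h) = e from hn]
        · intro hn
          have : (n : ZMod h) = ((n % h : ℕ) : ZMod h) := by simp
          rw [residueSet, Set.mem_ofPred_eq, this, hn]
          simp
      rw [h6, h5]
      exact ⟨fun h7 => (hζ.pow_inj e.val_lt (Nat.mod_lt _ (NeZero.pos h)) h7).symm,
        fun h7 => by rw [h7]⟩
    have h7 : ∑ i ∈ Finset.range h, (ζ ^ i)⁻¹ ^ e.val * (PowerSeries.coeff n P * (ζ ^ i * z) ^ n) =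
        PowerSeries.coeff n P * z ^ n * ∑ i ∈ Finset.range h, (ζ ^ n / ζ ^ e.val) ^ i := by
      rw [Finset.mul_sum]
      refine Finset.sum_congr rfl fun i _ => ?_
      rw [div_pow, mul_pow, ← pow_mul, ← pow_mul, inv_pow, ← pow_mul, ← pow_mul, mul_comm n i,
        mul_comm e.val i]
      ring
    rw [h7, h3, rationalOp, PowerSeries.coeff_mk]
    by_cases hn : n ∈ residueSet h e
    · rw [if_pos hn, if_pos (h4.2 hn)]
      field_simp
    · rw [if_neg hn, if_neg fun h8 => hn (h4.1 h8)]
      simp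
  · obtain ⟨-, U, hU, hsub, hm⟩ := hf
    -- The closed disc is invariant under rotation, so it lies in every rotated copy of `U`.
    refine ⟨⋂ i ∈ Finset.range h, (fun z => ζ ^ i * z) ⁻¹' U,
      isOpen_biInter_finset fun i _ => hU.preimage (by fun_prop), fun z hz => ?_, fun z hz => ?_⟩
    · simp only [Set.mem_iInter, Set.mem_preimage]
      intro i _
      refine hsub ?_
      rw [mem_closedBall_zero_iff, norm_pow_mul_of_isPrimitiveRoot hζ hh]
      simpa using hz
    · simp only [Set.mem_iInter, Set.mem_preimage] at hz
      refine (MeromorphicAt.const _ z).mul (MeromorphicAt.fun_sum fun i hi => ?_)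
      exact (MeromorphicAt.const _ z).mul
        ((hm _ (hz i hi)).comp_analyticAt (g := fun z => ζ ^ i * z) (by fun_prop))

/-- The rotated function `f(ζⁱ z)` has at `x` the leading coefficient of `f` at `ζⁱ x`. These points
are all the `h`-th roots of `A`; they include `S`, and `c` vanishes at the others. -/
theorem tendsto_rotationAverage [NeZero h] {ζ : ℂ} (hζ : IsPrimitiveRoot ζ h) (hr : 0 < r)
    {S : Finset ℂ} {c : ℂ → ℂ} {m : ℕ} {A : ℂ} (hS : ∀ x, x ∈ S ↔ ‖x‖ = r ∧ c x ≠ 0)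
    (hA : ∀ x ∈ S, x ^ h = A)
    (hc : ∀ x : ℂ, ‖x‖ = r →
      Tendsto (fun z => (1 - z / x) ^ (m + 1) * f z) (𝓝[≠] x) (𝓝 (c x)))
    (e : ZMod h) {x : ℂ} (hx : ‖x‖ = r) (hxA : x ^ h = A) :
    Tendsto (fun z => (1 - z / x) ^ (m + 1) * rotationAverage ζ f e z) (𝓝[≠] x)
      (𝓝 (x ^ e.val * expSum S c e.val / h)) := by
  have hh : h ≠ 0 := NeZero.ne h
  have hζ0 : ζ ≠ 0 := hζ.ne_zero hh
  have hx0 : x ≠ 0 := norm_pos_iff.1 (hx ▸ hr)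
  have h1 : ∀ i : ℕ, Tendsto (fun z => (1 - z / x) ^ (m + 1) * f (ζ ^ i * z)) (𝓝[≠] x)
      (𝓝 (c (ζ ^ i * x))) := by
    intro i
    have hi0 : ζ ^ i ≠ 0 := pow_ne_zero _ hζ0
    have h2 : Tendsto (fun z => ζ ^ i * z) (𝓝[≠] x) (𝓝[≠] (ζ ^ i * x)) := by
      refine tendsto_nhdsWithin_iff.2 ⟨?_, ?_⟩
      · exact ((continuous_const_mul (ζ ^ i)).tendsto x).mono_left nhdsWithin_le_nhds
      · filter_upwards [self_mem_nhdsWithin] with z hz hz'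
        exact hz (mul_left_cancel₀ hi0 hz')
    refine ((hc (ζ ^ i * x) ?_).comp h2).congr fun z => ?_
    · rw [norm_pow_mul_of_isPrimitiveRoot hζ hh, hx]
    · simp only [Function.comp_apply]
      rw [mul_div_mul_left _ _ hi0]
  have h2 : ∑ i ∈ Finset.range h, (ζ ^ i)⁻¹ ^ e.val * c (ζ ^ i * x) =
      x ^ e.val * expSum S c e.val := by
    classical
    have hinj : Set.InjOn (fun i => ζ ^ i * x) (Finset.range h) := fun i hi j hj hij =>
      hζ.pow_inj (Finset.mem_range.1 hi) (Finset.mem_range.1 hj) (mul_right_cancel₀ hx0 hij)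
    have hsub : S ⊆ (Finset.range h).image fun i => ζ ^ i * x := by
      intro y hy
      obtain ⟨i, hi, hiy⟩ := hζ.eq_pow_of_pow_eq_one (ξ := y / x)
        (by rw [div_pow, hA y hy, hxA, div_self (hxA ▸ pow_ne_zero _ hx0)])
      refine Finset.mem_image.2 ⟨i, Finset.mem_range.2 hi, ?_⟩
      rw [hiy, div_mul_cancel₀ _ hx0]
    rw [expSum, Finset.mul_sum, Finset.sum_subset hsub]
    · rw [Finset.sum_image hinj]
      refine Finset.sum_congr rfl fun i _ => ?_
      rw [mul_inv, mul_pow, mul_left_comm, mul_left_comm (x ^ e.val),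
        ← mul_pow x, mul_inv_cancel₀ hx0, one_pow, mul_one, mul_comm]
    · intro y hy hyS
      obtain ⟨i, -, rfl⟩ := Finset.mem_image.1 hy
      have : c (ζ ^ i * x) = 0 := by
        by_contra hcy
        exact hyS ((hS _).2 ⟨by rw [norm_pow_mul_of_isPrimitiveRoot hζ hh, hx], hcy⟩)
      rw [this, zero_mul, mul_zero]
  have h3 := (tendsto_finsetSum (Finset.range h) fun i _ =>
    (h1 i).const_mul ((ζ ^ i)⁻¹ ^ e.val)).const_mul (h : ℂ)⁻¹
  rw [h2, inv_mul_eq_div] at h3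
  refine h3.congr fun z => ?_
  rw [rotationAverage, mul_left_comm, Finset.mul_sum (Finset.range h) _ ((1 - z / x) ^ (m + 1))]
  simp only [mul_left_comm]

theorem tendsto_transitionQuotient [NeZero h] (hr : 0 < r)
    (hP : MemMeromorphicClass r P) {S : Finset ℂ} {c : ℂ → ℂ} {m : ℕ} {A : ℂ}
    (hS : ∀ x, x ∈ S ↔ ‖x‖ = r ∧ c x ≠ 0) (hA : ∀ x ∈ S, x ^ h = A)
    (h0 : ∀ n, expSum S c n ≠ 0)
    (hc : ∀ x : ℂ, ‖x‖ = r → Tendsto (fun z => (1 - z / x) ^ (m + 1) * meromorphicExtension r P z)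
      (𝓝[≠] x) (𝓝 (c x)))
    (e : ZMod h) {x : ℂ} (hx : x ∈ S) :
    Tendsto (transitionQuotient r P h e) (𝓝[≠] x) (𝓝 (leadingRatio S c e x * h)) := by
  have hζ := Complex.isPrimitiveRoot_exp h (NeZero.ne h)
  have hhc : (h : ℂ) ≠ 0 := Nat.cast_ne_zero.2 (NeZero.ne h)
  have hxr := ((hS x).1 hx).1
  have hx0 : x ≠ 0 := norm_pos_iff.1 (hxr ▸ hr)
  have hF := hP.isMeromorphicExtension.rotationAverage hζ e
  have hFe : MemMeromorphicClass r (rationalOp (residueSet h e) P) := ⟨_, hF⟩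
  have h1 := tendsto_rotationAverage hζ hr hS hA hc e hxr (hA x hx)
  have h2 : x ^ e.val * expSum S c e.val / h ≠ 0 :=
    div_ne_zero (mul_ne_zero (pow_ne_zero _ hx0) (h0 _)) hhc
  have h3 := (hc x hxr).div h1 h2
  have h4 : c x / (x ^ e.val * expSum S c e.val / h) = leadingRatio S c e x * h := by
    have := h0 e.val
    rw [leadingRatio, inv_pow]
    field_simp
  rw [h4] at h3
  refine h3.congr' ?_
  -- The chosen extension of `T^[e] P` need only agree with the rotation average off `x`; the common
  -- factor `(1 - z/x)^(m+1)` cancels there.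
  filter_upwards [hFe.isMeromorphicExtension.eventuallyEq hr hF hxr, self_mem_nhdsWithin]
    with z hz hzx
  have h5 : (1 - z / x) ^ (m + 1) ≠ 0 := by
    refine pow_ne_zero _ (sub_ne_zero.2 fun h => hzx ?_)
    rw [eq_comm, div_eq_one_iff_eq hx0] at h
    exact h
  rw [transitionQuotient, hz, Pi.div_apply, mul_div_mul_left _ _ h5]

end

end

/-! ### The duality theorem -/

theorem mainTheorem1 (P : PowerSeries ℂ) (hP : IsTame P)
    (hmero : MemMeromorphicClass (convRadius P) P)
    (h : ℕ) (hacc : IsFinRatAccumulating (oppositePoly P) h) :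
    -- the opposite series `a^[e]` that define `Δ^op` and `A^[e]` exist as limits
    (∀ e : ZMod h, Tendsto (oppositePoly P) (atTop ⊓ 𝓟 (residueSet h e))
      (𝓝 (oppositeSeries P h e))) ∧
    -- (i)
    ((topDenominator (convRadius P) P).natDegree = oppositeRank P ∧
      oppositeRank P = (oppositeDenominator P h).natDegree ∧
      Module.Finite ℂ (oppositeSpan P) ∧
      -- `t^d Δ^op(1/t) = Δ^top(t)` and `s^d Δ^top(1/s) = Δ^op(s)`
      (oppositeDenominator P h).reflect (oppositeRank P) = topDenominator (convRadius P) P ∧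
      (topDenominator (convRadius P) P).reflect (oppositeRank P) = oppositeDenominator P h ∧
      (topDenominator (convRadius P) P).rootSet ℂ =
        topPoles (convRadius P) (meromorphicExtension (convRadius P) P) ∧
      (topPoles (convRadius P) (meromorphicExtension (convRadius P) P)).ncard =
        oppositeRank P) ∧
    -- (ii)
    ((∀ e : ZMod h, MemMeromorphicClass (convRadius P) (rationalOp (residueSet h e) P)) ∧
      (∀ (e : ZMod h) (x : (topDenominator (convRadius P) P).rootSet ℂ),
        Tendsto (transitionQuotient (convRadius P) P h e) (𝓝[≠] (x : ℂ))
          (𝓝 (transitionMatrix (convRadius P) P h e x))) ∧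
      transitionMatrix (convRadius P) P h =
        Matrix.of (fun (e : ZMod h) (x : (topDenominator (convRadius P) P).rootSet ℂ) =>
          (numeratorPoly (oppositeInitial P h) e).eval (x : ℂ)⁻¹) ∧
      (transitionMatrix (convRadius P) P h).rank = oppositeRank P) := by
  have hh := hacc.pos
  have : NeZero h := ⟨hh.ne'⟩
  obtain ⟨hr, hrad⟩ := hP.convRadius_spec
  set r := convRadius P
  have hf := hmero.isMeromorphicExtension
  obtain ⟨m, S, c, hne, hS, hlim, hge, hSord⟩ := hf.exists_leading_coeff hr hrad
  have hSr : ∀ x ∈ S, ‖x‖ = r := fun x hx => ((hS x).1 hx).1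
  have hc : ∀ x ∈ S, c x ≠ 0 := fun x hx => ((hS x).1 hx).2
  have hS0 : ∀ x ∈ S, x ≠ 0 := fun x hx => norm_pos_iff.1 (hSr x hx ▸ hr)
  obtain ⟨hA, hG⟩ := pow_eq_cyclicProduct_and_recurrence hP hacc hr hSr hc hne
    (hf.tendsto_coeff_sub hr hS hlim)
  set a := oppositeInitial P h with ha
  have hA0 : cyclicProduct a ≠ 0 := Finset.prod_ne_zero_iff.2 fun i _ =>
    oppositeInitial_ne_zero hP hacc _
  have h0 := expSum_ne_zero hA hA0 hne hc (oppositeInitial_ne_zero hP hacc) hG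
  have htop : topDenominator r P = ∏ x ∈ S, (X - C x) := topDenominator_eq_prod hf hne hge hSord
  have hpoles : topPoles r (meromorphicExtension r P) = S := topPoles_eq hne hge hSord
  have hroot : (topDenominator r P).rootSet ℂ = S := by rw [htop, rootSet_prod_X_sub_C]
  have hspan : oppositeSpan P = Submodule.span ℂ (Set.range fun x : S => geomSeries x) := by
    rw [oppositeSpan, oppositeSpace_eq_range hP hacc]
    refine span_range_eq_span_geomSeries hA hA0 hc h0 fun e k => ?_
    rw [coeff_oppositeSeries hP hacc, prod_Icc_eq_sum_leadingRatio hA hA0 h0 hG]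
  have hrank : oppositeRank P = S.card := by
    rw [oppositeRank, hspan, finrank_span_eq_card (linearIndependent_geomSeries hA hA0),
      Fintype.card_coe]
  have hopp : oppositeDenominator P h = ∏ x ∈ S, (1 - C x * X) := by
    obtain ⟨R, hR, hprod⟩ := exists_finset_roots (h := h) (cyclicProduct a) hA0
    refine one_sub_div_commonFactor (R := R) (fun x hx hx0 => hA0 ?_)
      (fun x hx => (hR x).2 (hA x hx)) hprod fun x hx => ?_
    · rw [← (hR x).1 hx, hx0, zero_pow hh.ne']
    · rw [eval_numeratorPoly hA hA0 h0 hG 0 ((hR x).1 hx)]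
      by_cases hxS : x ∈ S
      · have h1 : leadingRatio S c (0 : ZMod h) x ≠ 0 :=
          div_ne_zero (mul_ne_zero (hc x hxS) (pow_ne_zero _ (inv_ne_zero (hS0 x hxS)))) (h0 _)
        simp [hxS, h1, hh.ne']
      · simp [hxS]
  have hroot' : ∀ x : (topDenominator r P).rootSet ℂ, (x : ℂ) ∈ S := fun x =>
    hroot.subset x.2
  have hquot : ∀ (e : ZMod h) (x : (topDenominator r P).rootSet ℂ),
      Tendsto (transitionQuotient r P h e) (𝓝[≠] (x : ℂ)) (𝓝 (leadingRatio S c e x * h)) :=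
    fun e x => tendsto_transitionQuotient hr hmero hS hA h0 hlim e (hroot' x)
  have hmat : transitionMatrix r P h =
      Matrix.of fun (e : ZMod h) (x : (topDenominator r P).rootSet ℂ) =>
        leadingRatio S c e x * h := by
    ext e x
    exact (hquot e x).limUnder_eq
  refine ⟨tendsto_oppositeSeries hP hacc, ⟨?_, ?_, ?_, ?_, ?_, ?_, ?_⟩, ?_, ?_, ?_, ?_⟩
  · rw [htop, hrank, natDegree_prod_of_monic _ _ fun x _ => monic_X_sub_C x]
    simp
  · rw [hopp, hrank, natDegree_prod_one_sub hS0]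
  · rw [hspan]
    exact Module.Finite.span_of_finite ℂ (Set.finite_range _)
  · rw [hopp, hrank, htop, reflect_prod_one_sub]
  · rw [hopp, hrank, htop, ← reflect_prod_one_sub, reflect_reflect]
  · rw [hroot, hpoles]
  · rw [hpoles, hrank, Set.ncard_coe_finset]
  · exact fun e => ⟨_, hf.rotationAverage (Complex.isPrimitiveRoot_exp h hh.ne') e⟩
  · intro e x
    rw [hmat]
    exact hquot e x
  · rw [hmat]
    ext e x
    rw [Matrix.of_apply, Matrix.of_apply, eval_numeratorPoly hA hA0 h0 hG e (hA x (hroot' x)),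
      if_pos (hroot' x)]
  · rw [hmat, rank_leadingRatio_mul hA hA0 hc h0 Subtype.val_injective hroot', hrank,
      ← Nat.card_eq_fintype_card, Nat.card_coe_set_eq, hroot, Set.ncard_coe_finset]
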